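/- Let $K$ be an algebraically closed field and let $\varGamma$ be the quiver with four vertices $e_0,e_1,e_2,e_3$ and eight arrows $a_{l,m}\colon e_m\to e_{m+1}$ ($l\in\mathbb{Z}/2$, $m\in\mathbb{Z}/4$, indices of vertices taken modulo $4$). Write paths from left to right, and put $x_l:=\sum_{m=0}^{3}a_{l,m}\in K\varGamma$, the subscript $l$ of $x_l$ being taken modulo $2$. Let $q_0,q_1,q_2,q_3\in K\setminus\{0\}$ be such that the product $q_0q_1q_2q_3$ is not a root of unity, and let $$A=A_0(q_0,q_1,q_2,q_3):=K\varGamma\big/\big\langle x_0x_1,\ x_1x_0,\ e_i(q_ix_i^{2}+x_{i+1}^{2})\ \big|\ 0\le i\le 3\big\rangle .$$ Let $\mathrm{HH}^*(A)=\bigoplus_{n\ge0}\mathrm{Ext}^n_{A^{\mathrm e}}(A,A)$, where $A^{\mathrm e}=A^{\mathrm{op}}\otimes_K A$, be the Hochschild cohomology ring of $A$ with the Yoneda product, and let $\mathcal{N}_A$ be the ideal of $\mathrm{HH}^*(A)$ generated by all homogeneous nilpotent elements. Then $\mathrm{HH}^*(A)$ is a local $K$-algebra of dimension $4$ over $K$,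 and $\mathrm{HH}^*(A)/\mathcal{N}_A$ is isomorphic to $K$ as a $K$-algebra. -/

import Mathlib

open scoped TensorProduct DirectSum

universe u

/-! ### Path algebras -/

/-- The paths of a quiver, of arbitrary origin and terminus (the path `p` from `a` to `b` is the
triple `⟨a, b, p⟩`). -/
abbrev QuiverPath (V : Type*) [Quiver V] : Type _ := Σ a b : V, Quiver.Path a b

/-- The path algebra `KΓ` of a quiver with vertex type `V`: the vector space on the set of paths.
Paths are written from left to right. -/
def PathAlgebra (K : Type*) (V : Type*) [Quiver V] [Field K] : Type _ := QuiverPath V →₀ K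

namespace PathAlgebra

noncomputable section

variable {K V : Type*} [Quiver V] [Field K]

instance : AddCommGroup (PathAlgebra K V) := inferInstanceAs (AddCommGroup (QuiverPath V →₀ K))

instance : Module K (PathAlgebra K V) := inferInstanceAs (Module K (QuiverPath V →₀ K))

/-- The element of the path algebra given by a path. -/
def ofPath (K : Type*) [Field K] {V : Type*} [Quiver V] (p : QuiverPath V) : PathAlgebra K V :=
  Finsupp.single p (1 : K)

@[elab_as_elim]
theorem induction {P : PathAlgebra K V → Prop} (x : PathAlgebra K V) (zero : P 0)
    (add : ∀ x y, P x → P y → P (x + y)) (smul : ∀ (c : K) p, P (c • ofPath K p)) : P x := by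
  refine Finsupp.induction_linear (motive := P) x zero add fun p c => ?_
  have h : (Finsupp.single p c : QuiverPath V →₀ K) = c • Finsupp.single p (1 : K) := by simp
  rw [h]
  exact smul c p

open Classical in
/-- The product of two paths: the concatenation `pq` if `p` ends where `q` starts, otherwise `0`. -/
def mulPath (K : Type*) [Field K] {V : Type*} [Quiver V] (p q : QuiverPath V) :
    PathAlgebra K V :=
  if h : p.2.1 = q.1 then ofPath K ⟨p.1, q.2.1, p.2.2.comp (q.2.2.cast h.symm rfl)⟩ else 0

/-- The linear extension of a function on paths. -/
def extend {M : Type*} [AddCommGroup M] [Module K M] (f : QuiverPath V → M) :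
    PathAlgebra K V →ₗ[K] M :=
  Finsupp.lift M K (QuiverPath V) f

theorem extend_ofPath {M : Type*} [AddCommGroup M] [Module K M] (f : QuiverPath V → M)
    (p : QuiverPath V) : extend (K := K) f (ofPath K p) = f p := by
  have h : Finsupp.lift M K (QuiverPath V) f (Finsupp.single p 1) = f p := by simp
  exact h

/-- The multiplication of the path algebra, the bilinear extension of `mulPath`. -/
def mulLin (K : Type*) [Field K] (V : Type*) [Quiver V] :
    PathAlgebra K V →ₗ[K] PathAlgebra K V →ₗ[K] PathAlgebra K V :=
  extend fun p => extend fun q => mulPath K p q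

instance : Mul (PathAlgebra K V) := ⟨fun x y => mulLin K V x y⟩

theorem mul_def (x y : PathAlgebra K V) : x * y = mulLin K V x y := rfl

theorem ofPath_mul_ofPath (p q : QuiverPath V) :
    ofPath K p * ofPath K q = mulPath K p q := by
  rw [mul_def, mulLin, extend_ofPath, extend_ofPath]

theorem mulPath_of_eq {a b c : V} (p : Quiver.Path a b) (q : Quiver.Path b c) :
    mulPath K ⟨a, b, p⟩ ⟨b, c, q⟩ = ofPath K ⟨a, c, p.comp q⟩ := by
  simp [mulPath]

theorem mulPath_of_ne {p q : QuiverPath V} (h : p.2.1 ≠ q.1) : mulPath K p q = 0 := by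
  simp [mulPath, h]

/-- The trivial path `e_v` at the vertex `v`. -/
def vertex (K : Type*) [Field K] {V : Type*} [Quiver V] (v : V) : PathAlgebra K V :=
  ofPath K ⟨v, v, Quiver.Path.nil⟩

/-- An arrow, regarded as an element of the path algebra. -/
def arrow (K : Type*) [Field K] {V : Type*} [Quiver V] {v w : V} (a : v ⟶ w) : PathAlgebra K V :=
  ofPath K ⟨v, w, a.toPath⟩

instance [Fintype V] : One (PathAlgebra K V) := ⟨∑ v : V, vertex K v⟩

theorem one_def [Fintype V] : (1 : PathAlgebra K V) = ∑ v : V, vertex K v := rfl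

instance : Distrib (PathAlgebra K V) where
  left_distrib x y z := by simp [mul_def]
  right_distrib x y z := by simp [mul_def]

instance : NonUnitalNonAssocRing (PathAlgebra K V) where
  zero_mul x := by simp [mul_def]
  mul_zero x := by simp [mul_def]

theorem smul_mul (c : K) (x y : PathAlgebra K V) : c • x * y = c • (x * y) := by
  simp [mul_def]

theorem mul_smul' (c : K) (x y : PathAlgebra K V) : x * c • y = c • (x * y) := by
  simp [mul_def]

theorem ofPath_mul_assoc (p q r : QuiverPath V) :
    ofPath K p * ofPath K q * ofPath K r = ofPath K p * (ofPath K q * ofPath K r) := by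
  obtain ⟨a, b, p⟩ := p
  obtain ⟨c, d, q⟩ := q
  obtain ⟨e, f, r⟩ := r
  simp only [ofPath_mul_ofPath]
  by_cases h₁ : b = c
  · subst h₁
    by_cases h₂ : d = e
    · subst h₂
      simp only [mulPath_of_eq, ofPath_mul_ofPath, Quiver.Path.comp_assoc]
    · rw [mulPath_of_eq, ofPath_mul_ofPath, mulPath_of_ne h₂, mulPath_of_ne h₂, mul_zero]
  · rw [mulPath_of_ne (p := ⟨a, b, p⟩) (q := ⟨c, d, q⟩) h₁, zero_mul]
    by_cases h₂ : d = e
    · subst h₂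
      rw [mulPath_of_eq, ofPath_mul_ofPath, mulPath_of_ne h₁]
    · rw [mulPath_of_ne h₂, mul_zero]

theorem mul_assoc' (x y z : PathAlgebra K V) : x * y * z = x * (y * z) := by
  refine induction x (by simp) (fun x₁ x₂ h₁ h₂ => by simp only [add_mul, h₁, h₂]) fun a p => ?_
  refine induction y (by simp) (fun x₁ x₂ h₁ h₂ => by simp only [add_mul, mul_add, h₁, h₂])
    fun b q => ?_
  refine induction z (by simp) (fun x₁ x₂ h₁ h₂ => by simp only [mul_add, h₁, h₂]) fun c r => ?_
  simp only [smul_mul, mul_smul', ofPath_mul_assoc]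

variable [Fintype V]

theorem one_mul' (x : PathAlgebra K V) : 1 * x = x := by
  classical
  refine induction x (by simp) (fun x₁ x₂ h₁ h₂ => by simp only [mul_add, h₁, h₂]) fun c p => ?_
  obtain ⟨a, b, p⟩ := p
  rw [mul_smul', one_def, Finset.sum_mul, Finset.sum_eq_single a]
  · rw [vertex, ofPath_mul_ofPath, mulPath_of_eq, Quiver.Path.nil_comp]
  · intro v _ hv
    rw [vertex, ofPath_mul_ofPath, mulPath_of_ne hv]
  · simp

theorem mul_one' (x : PathAlgebra K V) : x * 1 = x := by
  classical
  refine induction x (by simp) (fun x₁ x₂ h₁ h₂ => by simp only [add_mul, h₁, h₂]) fun c p => ?_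
  obtain ⟨a, b, p⟩ := p
  rw [smul_mul, one_def, Finset.mul_sum, Finset.sum_eq_single b]
  · rw [vertex, ofPath_mul_ofPath, mulPath_of_eq, Quiver.Path.comp_nil]
  · intro v _ hv
    rw [vertex, ofPath_mul_ofPath, mulPath_of_ne (Ne.symm hv)]
  · simp

instance : Ring (PathAlgebra K V) where
  __ := (inferInstance : NonUnitalNonAssocRing (PathAlgebra K V))
  mul_assoc := mul_assoc'
  one_mul := one_mul'
  mul_one := mul_one'

instance : Algebra K (PathAlgebra K V) := Algebra.ofModule smul_mul mul_smul'

end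

end PathAlgebra

/-! ### The algebra `A_T(q₀, q₁, q₂, q₃)` -/

/-- The vertices `e_0, e_1, e_2, e_3` of the quiver `Γ`, indexed modulo `4`. -/
def GammaVertex : Type := ZMod 4

namespace GammaVertex

instance : CommRing GammaVertex := inferInstanceAs (CommRing (ZMod 4))

instance : Fintype GammaVertex := inferInstanceAs (Fintype (ZMod 4))

instance : DecidableEq GammaVertex := inferInstanceAs (DecidableEq (ZMod 4))

/-- The class modulo `2` of an index modulo `4`. -/
def mod2 (i : GammaVertex) : ZMod 2 := ZMod.castHom (by norm_num : 2 ∣ 4) (ZMod 2) i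

end GammaVertex

/-- The arrows of `Γ`: for `l` modulo `2` and `m` modulo `4` an arrow `a_{l,m}` from `e_m` to
`e_{m+1}`, and no others. -/
inductive GammaArrow : GammaVertex → GammaVertex → Type
  | a (l : ZMod 2) (m : GammaVertex) : GammaArrow m (m + 1)

instance : Quiver GammaVertex := ⟨GammaArrow⟩

noncomputable section

/-- The idempotent `e_i` of `KΓ`. -/
abbrev gammaE (K : Type u) [Field K] (i : GammaVertex) : PathAlgebra K GammaVertex :=
  PathAlgebra.vertex K i

/-- The element `x_l = ∑_m a_{l,m}` of `KΓ`. -/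
def gammaX (K : Type u) [Field K] (l : ZMod 2) : PathAlgebra K GammaVertex :=
  ∑ m : GammaVertex, PathAlgebra.arrow K (V := GammaVertex) (w := m + 1) (GammaArrow.a l m)

/-- The generators `x_l x_{l+1}` and `e_i (q_i x_i^{4T+2} + x_{i+1}^{4T+2})` of the ideal
`I_T(q₀, q₁, q₂, q₃)`. -/
def gammaRelations {K : Type u} [Field K] (T : ℕ) (q : GammaVertex → K) :
    Set (PathAlgebra K GammaVertex) :=
  {r | ∃ l : ZMod 2, r = gammaX K l * gammaX K (l + 1)} ∪
  {r | ∃ i : GammaVertex, r = gammaE K i *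
    (q i • gammaX K i.mod2 ^ (4 * T + 2) + gammaX K (i.mod2 + 1) ^ (4 * T + 2))}

/-- The algebra `A_T(q₀, q₁, q₂, q₃) = KΓ / I_T(q₀, q₁, q₂, q₃)`. -/
abbrev GammaAlgebra {K : Type u} [Field K] (T : ℕ) (q : GammaVertex → K) : Type u :=
  (TwoSidedIdeal.span (gammaRelations T q)).ringCon.Quotient

end

/-! ### The Hochschild cohomology ring -/

section Hochschild

open CategoryTheory CategoryTheory.Abelian

noncomputable section

variable (K : Type u) [Field K] (A : Type u) [Ring A] [Algebra K A]

/-- `A` as an `A`-`A`-bimodule, that is, as a left module over `A ⊗ Aᵒᵖ` (equivalently, as a right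
module over the enveloping algebra `Aᵒᵖ ⊗ A`); `a ⊗ b` acts by `x ↦ a x b`. -/
def regularBimodule : ModuleCat.{u} (A ⊗[K] Aᵐᵒᵖ) :=
  letI := instModuleTensorProductMop K A
  ModuleCat.of (A ⊗[K] Aᵐᵒᵖ) A

/-- The Hochschild cohomology group `HHⁿ(A) = Extⁿ(A, A)` over the enveloping algebra. -/
def HochschildCohomology (n : ℕ) : Type u :=
  Ext.{u} (regularBimodule K A) (regularBimodule K A) n

namespace HochschildCohomology

instance (n : ℕ) : AddCommGroup (HochschildCohomology K A n) :=
  inferInstanceAs (AddCommGroup (Ext.{u} (regularBimodule K A) (regularBimodule K A) n))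

instance (n : ℕ) : Module K (HochschildCohomology K A n) :=
  inferInstanceAs (Module K (Ext.{u} (regularBimodule K A) (regularBimodule K A) n))

variable {K A}

/-- The Yoneda product. -/
def yoneda {m n : ℕ} (α : HochschildCohomology K A m) (β : HochschildCohomology K A n) :
    HochschildCohomology K A (m + n) :=
  Ext.comp (X := regularBimodule K A) (Y := regularBimodule K A) (Z := regularBimodule K A)
    α β rfl

variable (K A) in
/-- The identity of `A`, as an element of `HH⁰(A)`. -/
def unit : HochschildCohomology K A 0 := Ext.mk₀ (𝟙 (regularBimodule K A))

variable (K A) in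
/-- The unit map `K → HH⁰(A)`. -/
def ofScalar : K →+ HochschildCohomology K A 0 where
  toFun c := c • unit K A
  map_zero' := zero_smul _ _
  map_add' _ _ := add_smul _ _ _

theorem yoneda_assoc {l m n : ℕ} (α : HochschildCohomology K A l)
    (β : HochschildCohomology K A m) (γ : HochschildCohomology K A n) :
    GradedMonoid.mk (l + m + n) (yoneda (yoneda α β) γ) =
      GradedMonoid.mk (l + (m + n)) (yoneda α (yoneda β γ)) := by
  have key : ∀ (k : ℕ) (h : l + m + n = k),
      GradedMonoid.mk (A := HochschildCohomology K A) (l + m + n) (yoneda (yoneda α β) γ) =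
        GradedMonoid.mk k (Ext.comp (X := regularBimodule K A) (Y := regularBimodule K A)
          (Z := regularBimodule K A) α (yoneda β γ) ((add_assoc l m n).symm.trans h)) := by
    rintro _ rfl
    exact congrArg _ (Ext.comp_assoc (X := regularBimodule K A) (Y := regularBimodule K A)
      (Z := regularBimodule K A) (T := regularBimodule K A) α β γ rfl rfl rfl)
  exact key _ (add_assoc l m n)

theorem unit_yoneda {n : ℕ} (α : HochschildCohomology K A n) :
    GradedMonoid.mk (0 + n) (yoneda (unit K A) α) = GradedMonoid.mk n α := by
  have key : ∀ (k : ℕ) (h : 0 + n = k),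
      GradedMonoid.mk (A := HochschildCohomology K A) (0 + n) (yoneda (unit K A) α) =
        GradedMonoid.mk k (Ext.comp (X := regularBimodule K A) (Y := regularBimodule K A)
          (Z := regularBimodule K A) (unit K A) α h) := by
    rintro _ rfl
    rfl
  exact (key n (zero_add n)).trans (congrArg _ (Ext.mk₀_id_comp (X := regularBimodule K A)
    (Y := regularBimodule K A) α))

theorem yoneda_unit {n : ℕ} (α : HochschildCohomology K A n) :
    GradedMonoid.mk (n + 0) (yoneda α (unit K A)) = GradedMonoid.mk n α :=
  congrArg _ (Ext.comp_mk₀_id (X := regularBimodule K A) (Y := regularBimodule K A) α)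

theorem smul_yoneda {m n : ℕ} (c : K) (α : HochschildCohomology K A m)
    (β : HochschildCohomology K A n) : yoneda (c • α) β = c • yoneda α β :=
  Ext.smul_comp (X := regularBimodule K A) (Y := regularBimodule K A)
    (Z := regularBimodule K A) α β rfl c

theorem yoneda_smul {m n : ℕ} (c : K) (α : HochschildCohomology K A m)
    (β : HochschildCohomology K A n) : yoneda α (c • β) = c • yoneda α β :=
  Ext.comp_smul (X := regularBimodule K A) (Y := regularBimodule K A)
    (Z := regularBimodule K A) α β rfl c

instance : GradedMonoid.GMul (HochschildCohomology K A) := ⟨yoneda⟩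

instance : GradedMonoid.GOne (HochschildCohomology K A) := ⟨unit K A⟩

instance : GradedMonoid.GMonoid (HochschildCohomology K A) where
  one_mul := fun ⟨_, α⟩ => unit_yoneda α
  mul_one := fun ⟨_, α⟩ => yoneda_unit α
  mul_assoc := fun ⟨_, α⟩ ⟨_, β⟩ ⟨_, γ⟩ => yoneda_assoc α β γ

instance : DirectSum.GRing (HochschildCohomology K A) where
  mul_zero {_ j} α := Ext.comp_zero (X := regularBimodule K A) (Y := regularBimodule K A)
    α (regularBimodule K A) j _ rfl
  zero_mul {i _} β := Ext.zero_comp (regularBimodule K A) (Y := regularBimodule K A)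
    (Z := regularBimodule K A) i β _ rfl
  mul_add α β γ := Ext.comp_add (X := regularBimodule K A) (Y := regularBimodule K A)
    (Z := regularBimodule K A) α β γ rfl
  add_mul α β γ := Ext.add_comp (X := regularBimodule K A) (Y := regularBimodule K A)
    (Z := regularBimodule K A) α β γ rfl
  natCast n := n • unit K A
  natCast_zero := zero_nsmul _
  natCast_succ n := succ_nsmul _ n
  intCast n := n • unit K A
  intCast_ofNat n := natCast_zsmul _ n
  intCast_negSucc_ofNat n := negSucc_zsmul _ n

theorem mk_smul {m n : ℕ} (c : K) {α : HochschildCohomology K A m}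
    {β : HochschildCohomology K A n} (h : GradedMonoid.mk m α = GradedMonoid.mk n β) :
    GradedMonoid.mk m (c • α) = GradedMonoid.mk n (c • β) :=
  congrArg (fun x : GradedMonoid (HochschildCohomology K A) => GradedMonoid.mk x.1 (c • x.2)) h

instance : DirectSum.GAlgebra K (HochschildCohomology K A) where
  toFun := ofScalar K A
  map_one := one_smul _ _
  map_mul r s := by
    change GradedMonoid.mk _ ((r * s) • unit K A) =
      GradedMonoid.mk _ (yoneda (r • unit K A) (s • unit K A))
    rw [smul_yoneda, yoneda_smul, smul_smul]
    exact mk_smul _ (yoneda_unit _).symm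
  commutes := fun r ⟨n, α⟩ => by
    change GradedMonoid.mk _ (yoneda (r • unit K A) α) =
      GradedMonoid.mk _ (yoneda α (r • unit K A))
    rw [smul_yoneda, yoneda_smul]
    exact mk_smul r ((unit_yoneda α).trans (yoneda_unit α).symm)
  smul_def := fun r ⟨n, α⟩ => by
    change GradedMonoid.mk _ (r • α) = GradedMonoid.mk _ (yoneda (r • unit K A) α)
    rw [smul_yoneda]
    exact mk_smul r (unit_yoneda α).symm

end HochschildCohomology

/-- The Hochschild cohomology ring `HH*(A) = ⨁ₙ HHⁿ(A)` with the Yoneda product, a graded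
`K`-algebra. -/
abbrev HochschildRing : Type u := ⨁ n : ℕ, HochschildCohomology K A n

/-- The (two-sided) ideal of `HH*(A)` generated by all homogeneous nilpotent elements. -/
def hochschildNilIdeal : TwoSidedIdeal (HochschildRing K A) :=
  TwoSidedIdeal.span {x | IsNilpotent x ∧
    ∃ (n : ℕ) (α : HochschildCohomology K A n), x = DirectSum.of (HochschildCohomology K A) n α}

end

end Hochschild

/-! With `ρ⁴ = q₀q₁q₂q₃`, rescaling the arrows turns `A` into a `ℤ/4`-cyclic cover of the quantum
exterior algebra `K⟨u, v⟩ / (u², v², vu + ρuv)`. The Koszul resolution of that algebra lifts to a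
resolution of `A` by projective bimodules, whose `n`-th term has a generator for each `0 ≤ b ≤ n`.
In the coordinates of `A` on `1`, `u`, `v`, `uv`, the cochain differential is made of twisted shift
operators `ρ ^ i • σ ∓ ρ ^ j`, where `σ` is the cyclic shift of the coordinate functions on the
vertices. As `ρ` is not a root of unity, these are invertible whenever `i ≠ j`, so that only the
cochains on which the scalars `ρ ^ i` and `ρ ^ j` agree contribute: the cohomology has dimensions
`1, 2, 1, 0, 0, …`. A finite-dimensional graded algebra that is `K` in degree zero is local, and the
classes of positive degree, all of them nilpotent, generate its maximal ideal. -/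

/-! ### Cyclic covers of the quantum exterior algebra -/

/-- The data exhibiting `A` as the cyclic cover, with group `ZMod N`, of the quantum exterior
algebra `K⟨u, v⟩ / (u², v², vu + ρ uv)`, whose two generators have degree one. -/
structure QuantumCover (N : ℕ) [NeZero N] (K A : Type*) [Field K] [Ring A] [Algebra K A]
    (ρ : K) where
  /-- The idempotent at each vertex. -/
  e : ZMod N → A
  /-- The generator `u`. -/
  u : A
  /-- The generator `v`. -/
  v : A
  /-- The basis of the monomials `e i`, `e i * u`, `e i * v` and `e i * (u * v)`. -/
  basis : Module.Basis (ZMod N × Fin 4) K A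
  e_mul_e : ∀ i j, e i * e j = if i = j then e i else 0
  sum_e : ∑ i, e i = 1
  e_mul_u : ∀ i, e i * u = u * e (i + 1)
  e_mul_v : ∀ i, e i * v = v * e (i + 1)
  u_mul_u : u * u = 0
  v_mul_v : v * v = 0
  v_mul_u : v * u = -(ρ • (u * v))
  basis_apply : ∀ i m, basis (i, m) = e i * (![1, u, v, u * v] : Fin 4 → A) m

section CyclicShift

variable (R M : Type*) [Semiring R] [AddCommMonoid M] [Module R M] (N : ℕ)

/-- The shift `f ↦ f (· + 1)` of the functions on a cyclic group. -/
def cyclicShift : (ZMod N → M) ≃ₗ[R] (ZMod N → M) :=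
  LinearEquiv.funCongrLeft R M (Equiv.addRight 1)

variable {R M N}

theorem cyclicShift_apply (f : ZMod N → M) (i : ZMod N) : cyclicShift R M N f i = f (i + 1) := rfl

theorem cyclicShift_single [DecidableEq (ZMod N)] (i : ZMod N) (c : M) :
    cyclicShift R M N (Pi.single i c) = Pi.single (i - 1) c := by
  ext j
  simp only [cyclicShift_apply, Pi.single_apply, eq_sub_iff_add_eq]

end CyclicShift

namespace QuantumCover

noncomputable section

open MulOpposite

variable {N : ℕ} [NeZero N] {K A : Type*} [Field K] [Ring A] [Algebra K A] {ρ : K}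
  (S : QuantumCover N K A ρ)

theorem u_mul_v_mul_u : S.u * S.v * S.u = 0 := by
  rw [mul_assoc, S.v_mul_u, mul_neg, mul_smul_comm, ← mul_assoc, S.u_mul_u, zero_mul, smul_zero,
    neg_zero]

theorem v_mul_u_mul_v : S.v * (S.u * S.v) = 0 := by
  rw [← mul_assoc, S.v_mul_u, neg_mul, smul_mul_assoc, mul_assoc, S.v_mul_v, mul_zero, smul_zero,
    neg_zero]

theorem u_mul_u_mul_v : S.u * (S.u * S.v) = 0 := by rw [← mul_assoc, S.u_mul_u, zero_mul]

theorem u_mul_e (i : ZMod N) : S.u * S.e i = S.e (i - 1) * S.u := by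
  rw [S.e_mul_u, sub_add_cancel]

theorem u_mul_e_mul (i : ZMod N) (a : A) : S.u * (S.e i * a) = S.e (i - 1) * (S.u * a) := by
  rw [← mul_assoc, S.u_mul_e, mul_assoc]

theorem v_mul_e (i : ZMod N) : S.v * S.e i = S.e (i - 1) * S.v := by
  rw [S.e_mul_v, sub_add_cancel]

theorem v_mul_e_mul (i : ZMod N) (a : A) : S.v * (S.e i * a) = S.e (i - 1) * (S.v * a) := by
  rw [← mul_assoc, S.v_mul_e, mul_assoc]

/-- The coordinates of an element along the `m`-th monomial, as a function of the vertex. -/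
def coord (m : Fin 4) : A →ₗ[K] (ZMod N → K) :=
  LinearMap.pi fun i => S.basis.coord (i, m)

theorem coord_apply (m : Fin 4) (a : A) (i : ZMod N) :
    S.coord m a i = S.basis.repr a (i, m) := rfl

theorem eq_of_coord_eq {a b : A} (h : ∀ m, S.coord m a = S.coord m b) : a = b :=
  S.basis.ext_elem fun p => congrFun (h p.2) p.1

theorem linearMap_ext {M : Type*} [AddCommMonoid M] [Module K M] {f g : A →ₗ[K] M}
    (h_one : ∀ i, f (S.e i) = g (S.e i)) (h_u : ∀ i, f (S.e i * S.u) = g (S.e i * S.u))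
    (h_v : ∀ i, f (S.e i * S.v) = g (S.e i * S.v))
    (h_uv : ∀ i, f (S.e i * (S.u * S.v)) = g (S.e i * (S.u * S.v))) : f = g := by
  refine S.basis.ext fun ⟨i, m⟩ => ?_
  fin_cases m
  · simpa [S.basis_apply] using h_one i
  · simpa [S.basis_apply] using h_u i
  · simpa [S.basis_apply] using h_v i
  · simpa [S.basis_apply] using h_uv i

theorem coord_basis (m m' : Fin 4) (i : ZMod N) :
    S.coord m (S.basis (i, m')) = if m = m' then Pi.single i 1 else 0 := by
  ext j
  rw [coord_apply, Module.Basis.repr_self, Finsupp.single_apply]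
  split_ifs <;> simp_all [eq_comm]

theorem coord_e (m : Fin 4) (i : ZMod N) :
    S.coord m (S.e i) = if m = 0 then Pi.single i 1 else 0 := by
  rw [← S.coord_basis m 0 i, S.basis_apply, Matrix.cons_val_zero, mul_one]

theorem coord_e_mul_u (m : Fin 4) (i : ZMod N) :
    S.coord m (S.e i * S.u) = if m = 1 then Pi.single i 1 else 0 := by
  rw [← S.coord_basis m 1 i, S.basis_apply, Matrix.cons_val_one, Matrix.cons_val_zero]

theorem coord_e_mul_v (m : Fin 4) (i : ZMod N) :
    S.coord m (S.e i * S.v) = if m = 2 then Pi.single i 1 else 0 := by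
  rw [← S.coord_basis m 2 i, S.basis_apply]
  rfl

theorem coord_e_mul_u_mul_v (m : Fin 4) (i : ZMod N) :
    S.coord m (S.e i * (S.u * S.v)) = if m = 3 then Pi.single i 1 else 0 := by
  rw [← S.coord_basis m 3 i, S.basis_apply]
  rfl

theorem coord_mul_u (m : Fin 4) (a : A) : S.coord m (a * S.u) =
    (![0, S.coord 0 a, 0, -(ρ • S.coord 2 a)] : Fin 4 → ZMod N → K) m := by
  have key : S.coord m ∘ₗ LinearMap.mulRight K S.u =
      (![0, S.coord 0, 0, -(ρ • S.coord 2)] : Fin 4 → A →ₗ[K] (ZMod N → K)) m := by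
    apply S.linearMap_ext <;> intro i <;> fin_cases m <;>
      simp [mul_assoc (S.e i), S.u_mul_u, S.v_mul_u, S.u_mul_v_mul_u, coord_e, coord_e_mul_u,
        coord_e_mul_v, coord_e_mul_u_mul_v]
  refine (LinearMap.congr_fun key a).trans ?_
  fin_cases m <;> rfl

theorem coord_mul_v (m : Fin 4) (a : A) : S.coord m (a * S.v) =
    (![0, 0, S.coord 0 a, S.coord 1 a] : Fin 4 → ZMod N → K) m := by
  have key : S.coord m ∘ₗ LinearMap.mulRight K S.v =
      (![0, 0, S.coord 0, S.coord 1] : Fin 4 → A →ₗ[K] (ZMod N → K)) m := by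
    apply S.linearMap_ext <;> intro i <;> fin_cases m <;>
      simp [mul_assoc, S.v_mul_v, coord_e, coord_e_mul_u, coord_e_mul_v, coord_e_mul_u_mul_v]
  refine (LinearMap.congr_fun key a).trans ?_
  fin_cases m <;> rfl

theorem coord_u_mul (m : Fin 4) (a : A) : S.coord m (S.u * a) =
    cyclicShift K K N ((![0, S.coord 0 a, 0, S.coord 2 a] : Fin 4 → ZMod N → K) m) := by
  have key : S.coord m ∘ₗ LinearMap.mulLeft K S.u = (cyclicShift K K N).toLinearMap ∘ₗ
      (![0, S.coord 0, 0, S.coord 2] : Fin 4 → A →ₗ[K] (ZMod N → K)) m := by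
    apply S.linearMap_ext <;> intro i <;> fin_cases m <;>
      simp [S.u_mul_e, S.u_mul_e_mul, S.u_mul_u, S.u_mul_u_mul_v, coord_e, coord_e_mul_u,
        coord_e_mul_v, coord_e_mul_u_mul_v, cyclicShift_single]
  refine (LinearMap.congr_fun key a).trans ?_
  fin_cases m <;> rfl

theorem coord_v_mul (m : Fin 4) (a : A) : S.coord m (S.v * a) =
    cyclicShift K K N ((![0, 0, S.coord 0 a, -(ρ • S.coord 1 a)] : Fin 4 → ZMod N → K) m) := by
  have key : S.coord m ∘ₗ LinearMap.mulLeft K S.v = (cyclicShift K K N).toLinearMap ∘ₗ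
      (![0, 0, S.coord 0, -(ρ • S.coord 1)] : Fin 4 → A →ₗ[K] (ZMod N → K)) m := by
    apply S.linearMap_ext <;> intro i <;> fin_cases m <;>
      simp [S.v_mul_e, S.v_mul_e_mul, S.v_mul_u, S.v_mul_v, S.v_mul_u_mul_v, coord_e,
        coord_e_mul_u, coord_e_mul_v, coord_e_mul_u_mul_v, cyclicShift_single]
  refine (LinearMap.congr_fun key a).trans ?_
  fin_cases m <;> rfl

/-! ### The Koszul complex -/

/-- The coordinates along the `m`-th monomial of the left tensor factor of the enveloping algebra,
as a function of the vertex. -/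
def envCoord (m : Fin 4) : A ⊗[K] Aᵐᵒᵖ →ₗ[K] (ZMod N → Aᵐᵒᵖ) :=
  LinearMap.pi fun i => Finsupp.lapply (i, m) ∘ₗ
    (TensorProduct.equivFinsuppOfBasisLeft S.basis : A ⊗[K] Aᵐᵒᵖ ≃ₗ[K] _).toLinearMap

theorem envCoord_tmul (m : Fin 4) (a : A) (w : Aᵐᵒᵖ) :
    S.envCoord m (a ⊗ₜ w) = fun i => S.coord m a i • w := by
  ext1 i
  exact TensorProduct.equivFinsuppOfBasisLeft_apply_tmul_apply S.basis a w (i, m)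

theorem eq_of_envCoord_eq {x y : A ⊗[K] Aᵐᵒᵖ} (h : ∀ m, S.envCoord m x = S.envCoord m y) :
    x = y :=
  (TensorProduct.equivFinsuppOfBasisLeft S.basis).injective <|
    Finsupp.ext fun p => congrFun (h p.2) p.1

theorem exists_envCoord_eq (X : Fin 4 → ZMod N → Aᵐᵒᵖ) :
    ∃ x : A ⊗[K] Aᵐᵒᵖ, ∀ m, S.envCoord m x = X m := by
  let φ : A ⊗[K] Aᵐᵒᵖ ≃ₗ[K] (ZMod N × Fin 4 →₀ Aᵐᵒᵖ) :=
    TensorProduct.equivFinsuppOfBasisLeft S.basis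
  let X' : ZMod N × Fin 4 →₀ Aᵐᵒᵖ := Finsupp.equivFunOnFinite.symm fun p => X p.2 p.1
  exact ⟨φ.symm X', fun m => funext fun i => DFunLike.congr_fun (φ.apply_symm_apply X') (i, m)⟩

theorem envCoord_mul_one_tmul (m : Fin 4) (w : Aᵐᵒᵖ) (x : A ⊗[K] Aᵐᵒᵖ) :
    S.envCoord m (x * 1 ⊗ₜ w) = fun i => S.envCoord m x i * w := by
  induction x with
  | zero => simp only [zero_mul, map_zero, Pi.zero_apply]; rfl
  | add x y hx hy => simp only [add_mul, map_add, hx, hy, Pi.add_apply]; rfl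
  | tmul b w =>
    simp only [Algebra.TensorProduct.tmul_mul_tmul, mul_one, envCoord_tmul, smul_mul_assoc]

theorem envCoord_mul_u_tmul_one (m : Fin 4) (x : A ⊗[K] Aᵐᵒᵖ) : S.envCoord m (x * S.u ⊗ₜ 1) =
    (![0, S.envCoord 0 x, 0, -(ρ • S.envCoord 2 x)] : Fin 4 → ZMod N → Aᵐᵒᵖ) m := by
  induction x with
  | zero => fin_cases m <;> simp
  | add x y hx hy =>
    rw [add_mul, map_add, hx, hy]
    fin_cases m <;> simp [add_comm]
  | tmul b w =>
    rw [Algebra.TensorProduct.tmul_mul_tmul, envCoord_tmul, coord_mul_u]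
    ext1 i
    fin_cases m <;> simp [envCoord_tmul, smul_smul]

theorem envCoord_mul_v_tmul_one (m : Fin 4) (x : A ⊗[K] Aᵐᵒᵖ) : S.envCoord m (x * S.v ⊗ₜ 1) =
    (![0, 0, S.envCoord 0 x, S.envCoord 1 x] : Fin 4 → ZMod N → Aᵐᵒᵖ) m := by
  induction x with
  | zero => fin_cases m <;> simp
  | add x y hx hy =>
    rw [add_mul, map_add, hx, hy]
    fin_cases m <;> simp
  | tmul b w =>
    rw [Algebra.TensorProduct.tmul_mul_tmul, envCoord_tmul, coord_mul_v]
    ext1 i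
    fin_cases m <;> simp [envCoord_tmul]

/-- The coefficient of the Koszul differential that lowers the exponent of `u`. -/
def dU (n b : ℕ) : A ⊗[K] Aᵐᵒᵖ := ρ ^ b • S.u ⊗ₜ 1 + (-1 : K) ^ (n + 1) • 1 ⊗ₜ op S.u

/-- The coefficient of the Koszul differential that lowers the exponent of `v`. -/
def dV (n b : ℕ) : A ⊗[K] Aᵐᵒᵖ := S.v ⊗ₜ 1 + ((-1 : K) ^ (n + 1) * ρ ^ (n - b)) • 1 ⊗ₜ op S.v

/-- The differential of the Koszul complex, on free modules: the basis vector with index `b` in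
degree `n` stands for the dual of the monomial `u ^ (n - b) v ^ b`. -/
def freeD (n : ℕ) : (Fin (n + 2) → A ⊗[K] Aᵐᵒᵖ) →ₗ[A ⊗[K] Aᵐᵒᵖ] (Fin (n + 1) → A ⊗[K] Aᵐᵒᵖ) where
  toFun x b := x b.castSucc * S.dU n b + x b.succ * S.dV n b
  map_add' x y := by
    ext b
    simp only [Pi.add_apply, add_mul]
    abel
  map_smul' r x := by
    ext b
    simp only [Pi.smul_apply, smul_eq_mul, RingHom.id_apply, mul_add, mul_assoc]

theorem freeD_apply (n : ℕ) (x : Fin (n + 2) → A ⊗[K] Aᵐᵒᵖ) (b : Fin (n + 1)) :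
    S.freeD n x b = x b.castSucc * S.dU n b + x b.succ * S.dV n b := rfl

theorem dU_mul_dU (n b : ℕ) : S.dU (n + 1) b * S.dU n b = 0 := by
  simp only [dU, add_mul, mul_add, smul_mul_smul_comm, Algebra.TensorProduct.tmul_mul_tmul,
    ← op_mul, S.u_mul_u, mul_one, one_mul, op_zero, TensorProduct.zero_tmul,
    TensorProduct.tmul_zero]
  module

theorem dV_mul_dV (n b : ℕ) : S.dV (n + 1) (b + 1) * S.dV n b = 0 := by
  simp only [dV, add_mul, mul_add, mul_smul_comm, smul_mul_assoc,
    Algebra.TensorProduct.tmul_mul_tmul, ← op_mul, S.v_mul_v, mul_one, one_mul, op_zero,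
    TensorProduct.zero_tmul, TensorProduct.tmul_zero, Nat.add_sub_add_right]
  module

theorem dU_mul_dV {n b : ℕ} (hb : b ≤ n) :
    S.dU (n + 1) (b + 1) * S.dV n b + S.dV (n + 1) b * S.dU n b = 0 := by
  obtain ⟨c, rfl⟩ := Nat.exists_eq_add_of_le hb
  simp only [dU, dV, add_mul, mul_add, mul_smul_comm, smul_mul_assoc,
    Algebra.TensorProduct.tmul_mul_tmul, ← op_mul, S.v_mul_u, mul_one, one_mul, op_neg, op_smul,
    TensorProduct.neg_tmul, TensorProduct.tmul_neg, TensorProduct.tmul_smul,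
    ← TensorProduct.smul_tmul', Nat.add_sub_cancel_left, Nat.add_assoc]
  module

theorem freeD_freeD (n : ℕ) (x : Fin (n + 3) → A ⊗[K] Aᵐᵒᵖ) :
    S.freeD n (S.freeD (n + 1) x) = 0 := by
  ext1 b
  have h : S.dV (n + 1) b * S.dU n b + S.dU (n + 1) (b + 1) * S.dV n b = 0 := by
    rw [add_comm, S.dU_mul_dV (by omega)]
  simp only [freeD_apply, add_mul, mul_assoc, Fin.val_castSucc, Fin.val_succ, S.dU_mul_dU,
    S.dV_mul_dV, mul_zero, zero_add, add_zero, Fin.succ_castSucc, ← mul_add, h, Pi.zero_apply]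

theorem envCoord_mul_dU (m : Fin 4) (n b : ℕ) (x : A ⊗[K] Aᵐᵒᵖ) :
    S.envCoord m (x * S.dU n b) =
      ρ ^ b • (![0, S.envCoord 0 x, 0, -(ρ • S.envCoord 2 x)] : Fin 4 → ZMod N → Aᵐᵒᵖ) m +
        (-1 : K) ^ (n + 1) • fun i => S.envCoord m x i * op S.u := by
  simp only [dU, mul_add, mul_smul_comm, map_add, map_smul, envCoord_mul_u_tmul_one,
    envCoord_mul_one_tmul]

theorem envCoord_mul_dV (m : Fin 4) (n b : ℕ) (x : A ⊗[K] Aᵐᵒᵖ) :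
    S.envCoord m (x * S.dV n b) =
      (![0, 0, S.envCoord 0 x, S.envCoord 1 x] : Fin 4 → ZMod N → Aᵐᵒᵖ) m +
        ((-1 : K) ^ (n + 1) * ρ ^ (n - b)) • fun i => S.envCoord m x i * op S.v := by
  simp only [dV, mul_add, mul_smul_comm, map_add, map_smul, envCoord_mul_v_tmul_one,
    envCoord_mul_one_tmul]

/-- The chains from which every monomial of the left factor has been cleared that `u` or `v` could
have produced: all coordinates along `v` and `u v` vanish, and in the entry of `u ^ n` also those
along `u`. -/
def IsReduced {n : ℕ} (x : Fin (n + 1) → A ⊗[K] Aᵐᵒᵖ) : Prop :=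
  (∀ b, S.envCoord 2 (x b) = 0 ∧ S.envCoord 3 (x b) = 0) ∧ S.envCoord 1 (x 0) = 0

theorem exists_isReduced_sub_freeD {n : ℕ} (x : Fin (n + 1) → A ⊗[K] Aᵐᵒᵖ) :
    ∃ y, S.IsReduced (x - S.freeD n y) := by
  choose g hg using S.exists_envCoord_eq
  refine ⟨Fin.cons (g ![S.envCoord 1 (x 0) -
    ((-1 : K) ^ (n + 1) * ρ ^ n) • fun i => S.envCoord 3 (x 0) i * op S.v, 0, 0, 0])
    fun b => g ![S.envCoord 2 (x b), S.envCoord 3 (x b), 0, 0], fun b => ⟨?_, ?_⟩, ?_⟩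
  · cases b using Fin.cases with
    | zero => simp [freeD_apply, envCoord_mul_dU, envCoord_mul_dV, hg, funext_iff]
    | succ b =>
      simp [freeD_apply, envCoord_mul_dU, envCoord_mul_dV, hg, funext_iff]
  · cases b using Fin.cases with
    | zero => simp [freeD_apply, envCoord_mul_dU, envCoord_mul_dV, hg, funext_iff]
    | succ b =>
      simp [freeD_apply, envCoord_mul_dU, envCoord_mul_dV, hg, funext_iff]
  · simp [freeD_apply, envCoord_mul_dU, envCoord_mul_dV, hg, funext_iff]

theorem IsReduced.eq_zero {n : ℕ} {x : Fin (n + 2) → A ⊗[K] Aᵐᵒᵖ} (h : S.IsReduced x)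
    (hx : S.freeD n x = 0) : x = 0 := by
  obtain ⟨h23, h1⟩ := h
  have coord_eq_zero (m : Fin 4) (b : Fin (n + 1)) :
      S.envCoord m (x b.castSucc * S.dU n b) + S.envCoord m (x b.succ * S.dV n b) = 0 := by
    rw [← map_add, ← freeD_apply, hx, Pi.zero_apply, map_zero]
  simp only [envCoord_mul_dU, envCoord_mul_dV] at coord_eq_zero
  have h1_succ (b : Fin (n + 1)) : S.envCoord 1 (x b.succ) = 0 := by
    simpa [h23, funext_iff] using coord_eq_zero 3 b
  have h1_all (b : Fin (n + 2)) : S.envCoord 1 (x b) = 0 := b.cases h1 h1_succ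
  have h0_succ (b : Fin (n + 1)) : S.envCoord 0 (x b.succ) = 0 := by
    simpa [h23, funext_iff] using coord_eq_zero 2 b
  have h0_zero : S.envCoord 0 (x 0) = 0 := by
    simpa [h1_all, funext_iff] using coord_eq_zero 1 0
  funext b
  refine S.eq_of_envCoord_eq fun m => ?_
  rw [Pi.zero_apply, map_zero]
  fin_cases m
  exacts [b.cases h0_zero h0_succ, h1_all b, (h23 b).1, (h23 b).2]

theorem exists_freeD_eq {n : ℕ} {x : Fin (n + 2) → A ⊗[K] Aᵐᵒᵖ} (hx : S.freeD n x = 0) :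
    ∃ y, S.freeD (n + 1) y = x := by
  obtain ⟨y, hy⟩ := S.exists_isReduced_sub_freeD x
  refine ⟨y, (sub_eq_zero.1 (hy.eq_zero S ?_)).symm⟩
  rw [map_sub, hx, freeD_freeD, sub_zero]

end

end QuantumCover

/-! ### Extension groups from projective resolutions -/

section ExtGroups

open CategoryTheory CategoryTheory.Abelian

universe w v

/-- An exact sequence of projective modules ending in `Z`, as a projective resolution of `Z`. -/
noncomputable def projectiveResolutionOfExact {R : Type u} [Ring R] (Z : ModuleCat.{u} R)
    (X : ℕ → ModuleCat.{u} R) (d : ∀ n, X (n + 1) ⟶ X n) (ε : X 0 ⟶ Z)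
    (projective : ∀ n, Projective (X n)) (d_comp_d : ∀ n, d (n + 1) ≫ d n = 0)
    (d_comp_ε : d 0 ≫ ε = 0)
    (exact_succ : ∀ n (x : X (n + 1)), d n x = 0 → ∃ y, d (n + 1) y = x)
    (exact_zero : ∀ x : X 0, ε x = 0 → ∃ y, d 0 y = x)
    (surjective : Function.Surjective ε) : ProjectiveResolution Z where
  complex := ChainComplex.of X d d_comp_d
  projective := projective
  π := (ChainComplex.toSingle₀Equiv _ _).symm
    ⟨ε, (congrArg (· ≫ ε) (ChainComplex.of_d X d 0)).trans d_comp_ε⟩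
  quasiIso := ⟨fun n => by
    have of_d (n : ℕ) : (ChainComplex.of X d d_comp_d).d (n + 1) n = d n :=
      ChainComplex.of_d X d n
    cases n with
    | zero =>
      rw [ChainComplex.quasiIsoAt₀_iff, ShortComplex.quasiIso_iff_of_zeros' _ rfl rfl rfl]
      refine (ShortComplex.exact_and_epi_g_iff_of_iso (S₂ := ShortComplex.mk (d 0) ε d_comp_ε)
        (ShortComplex.isoMk (Iso.refl _) (Iso.refl _) (Iso.refl _) ?_ ?_)).2
        ⟨(ShortComplex.moduleCat_exact_iff _).2 exact_zero,
          (ModuleCat.epi_iff_surjective _).2 surjective⟩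
      · exact (Category.id_comp (d 0)).trans
          ((of_d 0).symm.trans (Category.comp_id _).symm)
      · refine (Category.id_comp ε).trans (Eq.trans ?_ (Category.comp_id _).symm)
        exact (ChainComplex.toSingle₀Equiv_symm_apply_f_zero
          (C := ChainComplex.of X d d_comp_d) ε ((congrArg (· ≫ ε) (of_d 0)).trans d_comp_ε)).symm
    | succ n =>
      rw [quasiIsoAt_iff_exactAt' (hL := ChainComplex.exactAt_succ_single_obj ..),
        HomologicalComplex.exactAt_iff' _ (n + 2) (n + 1) n (by simp) (by simp),
        ShortComplex.moduleCat_exact_iff]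
      change ∀ x : X (n + 1), (ChainComplex.of X d d_comp_d).d (n + 1) n x = 0 →
        ∃ y, (ChainComplex.of X d d_comp_d).d (n + 2) (n + 1) y = x
      rw [of_d n, of_d (n + 1)]
      exact exact_succ n⟩

variable {K : Type u} [Field K] {C : Type w} [Category.{v} C] [Abelian C] [Linear K C] {X Y : C}

variable (K Y) in
/-- The cocycles of degree `n` in the complex of morphisms from a projective resolution to `Y`. -/
def resolutionCocycles (P : ProjectiveResolution X) (n : ℕ) :
    Submodule K (P.complex.X n ⟶ Y) :=
  LinearMap.ker (Linear.leftComp K Y (P.complex.d (n + 1) n))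

theorem mem_resolutionCocycles {P : ProjectiveResolution X} {n : ℕ} {f : P.complex.X n ⟶ Y} :
    f ∈ resolutionCocycles K Y P n ↔ P.complex.d (n + 1) n ≫ f = 0 := Iff.rfl

variable [HasExt.{u} C]

theorem extMk_smul (P : ProjectiveResolution X) {n : ℕ} (c : K) {f : P.complex.X n ⟶ Y}
    (hf : P.complex.d (n + 1) n ≫ f = 0) (hcf : P.complex.d (n + 1) n ≫ (c • f) = 0) :
    P.extMk (c • f) (n + 1) rfl hcf = c • P.extMk f (n + 1) rfl hf := by
  rw [Ext.smul_eq_comp_mk₀, P.extMk_comp_mk₀]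
  congr 1
  rw [Linear.comp_smul, Category.comp_id]

variable (K Y) in
/-- The extension class of a cocycle on a projective resolution. -/
noncomputable def extClass (P : ProjectiveResolution X) (n : ℕ) :
    resolutionCocycles K Y P n →ₗ[K] Ext.{u} X Y n where
  toFun f := P.extMk f.1 (n + 1) rfl (mem_resolutionCocycles.1 f.2)
  map_add' f g := (P.add_extMk f.1 g.1 (n + 1) rfl (mem_resolutionCocycles.1 f.2)
    (mem_resolutionCocycles.1 g.2)).symm
  map_smul' c _ := extMk_smul P c _ _

/-- Recognises `Extⁿ⁺¹` as the target of any linear map on cochains that maps the cocycles onto it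
and, among the cocycles, vanishes exactly on the coboundaries. -/
theorem nonempty_ext_linearEquiv (P : ProjectiveResolution X) {n : ℕ} {V : Type*}
    [AddCommGroup V] [Module K V] (F : (P.complex.X (n + 1) ⟶ Y) →ₗ[K] V)
    (surj : ∀ w, ∃ f, P.complex.d (n + 2) (n + 1) ≫ f = 0 ∧ F f = w)
    (ker : ∀ f, P.complex.d (n + 2) (n + 1) ≫ f = 0 →
      (F f = 0 ↔ ∃ g, P.complex.d (n + 1) n ≫ g = f)) :
    Nonempty (Ext.{u} X Y (n + 1) ≃ₗ[K] V) := by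
  let F' : resolutionCocycles K Y P (n + 1) →ₗ[K] V := F ∘ₗ Submodule.subtype _
  have hF' : Function.Surjective F' := fun w =>
    let ⟨f, hf, hw⟩ := surj w
    ⟨⟨f, hf⟩, hw⟩
  have hE : Function.Surjective (extClass K Y P (n + 1)) := fun α =>
    let ⟨f, hf, h⟩ := P.extMk_surjective α (n + 2) rfl
    ⟨⟨f, hf⟩, h⟩
  have h : LinearMap.ker (extClass K Y P (n + 1)) = LinearMap.ker F' := by
    ext ⟨f, hf⟩
    exact (P.extMk_eq_zero_iff f (n + 2) rfl hf n rfl).trans (ker f hf).symm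
  exact ⟨((extClass K Y P (n + 1)).quotKerEquivOfSurjective hE).symm.trans
    ((Submodule.quotEquivOfEq _ _ h).trans (F'.quotKerEquivOfSurjective hF'))⟩

end ExtGroups

namespace QuantumCover

noncomputable section

open MulOpposite

attribute [local instance] instModuleTensorProductMop

section Action

variable {K A : Type*} [Field K] [Ring A] [Algebra K A]

theorem tmul_smul (a : A) (w : Aᵐᵒᵖ) (z : A) : (a ⊗ₜ[K] w) • z = a * z * unop w := by
  rw [TensorProduct.Algebra.smul_def, smul_eq_mul, mul_assoc]
  rfl

-- `zero_smul` does not fire here: the action is only a local instance.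
theorem tensor_zero_smul (z : A) : (0 : A ⊗[K] Aᵐᵒᵖ) • z = 0 := zero_smul (A ⊗[K] Aᵐᵒᵖ) z

theorem smul_tensor_smul (c : K) (r : A ⊗[K] Aᵐᵒᵖ) (z : A) : (c • r) • z = c • (r • z) := by
  induction r with
  | zero => rw [smul_zero, tensor_zero_smul, smul_zero]
  | add x y hx hy => rw [smul_add, add_smul, add_smul, smul_add, hx, hy]
  | tmul a w => rw [TensorProduct.smul_tmul', tmul_smul, tmul_smul, smul_mul_assoc, smul_mul_assoc]

end Action

variable {N : ℕ} [NeZero N] {K A : Type*} [Field K] [Ring A] [Algebra K A] {ρ : K}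
  (S : QuantumCover N K A ρ)

/-! ### The Koszul bimodule resolution -/

/-- The idempotent of the enveloping algebra that cuts out the elements of degree `n`, those going
from a vertex `i` to the vertex `i + n`. -/
def trunc (n : ℕ) : A ⊗[K] Aᵐᵒᵖ := ∑ i, S.e i ⊗ₜ op (S.e (i + n))

theorem trunc_mul_trunc (n : ℕ) : S.trunc n * S.trunc n = S.trunc n := by
  rw [trunc, Finset.sum_mul]
  refine Finset.sum_congr rfl fun i _ => ?_
  rw [Finset.mul_sum, Finset.sum_eq_single i]
  · simp [← op_mul, S.e_mul_e]
  · intro j _ hj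
    simp [S.e_mul_e, hj.symm]
  · simp

theorem trunc_succ_mul_tmul_one (n : ℕ) {a : A} (h : ∀ i, S.e i * a = a * S.e (i + 1)) :
    S.trunc (n + 1) * a ⊗ₜ 1 = a ⊗ₜ 1 * S.trunc n := by
  rw [trunc, trunc, Finset.sum_mul, Finset.mul_sum, ← Equiv.sum_comp (Equiv.addRight (1 : ZMod N))
    (fun i => a ⊗ₜ 1 * S.e i ⊗ₜ op (S.e (i + n)))]
  refine Finset.sum_congr rfl fun i _ => ?_
  simp only [Algebra.TensorProduct.tmul_mul_tmul, h, one_mul, mul_one, Equiv.coe_addRight]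
  rw [Nat.cast_succ, add_right_comm i, add_assoc i]

theorem trunc_succ_mul_one_tmul (n : ℕ) {a : A} (h : ∀ i, S.e i * a = a * S.e (i + 1)) :
    S.trunc (n + 1) * 1 ⊗ₜ op a = 1 ⊗ₜ op a * S.trunc n := by
  rw [trunc, trunc, Finset.sum_mul, Finset.mul_sum]
  refine Finset.sum_congr rfl fun i _ => ?_
  simp only [Algebra.TensorProduct.tmul_mul_tmul, one_mul, mul_one, ← op_mul, h]
  rw [Nat.cast_succ, add_assoc i]

theorem trunc_succ_mul_dU (n b : ℕ) : S.trunc (n + 1) * S.dU n b = S.dU n b * S.trunc n := by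
  simp only [dU, mul_add, add_mul, mul_smul_comm, smul_mul_assoc,
    S.trunc_succ_mul_tmul_one n S.e_mul_u, S.trunc_succ_mul_one_tmul n S.e_mul_u]

theorem trunc_succ_mul_dV (n b : ℕ) : S.trunc (n + 1) * S.dV n b = S.dV n b * S.trunc n := by
  simp only [dV, mul_add, add_mul, mul_smul_comm, smul_mul_assoc,
    S.trunc_succ_mul_tmul_one n S.e_mul_v, S.trunc_succ_mul_one_tmul n S.e_mul_v]

/-- Right multiplication by `trunc n` on the free chains of degree `n`. -/
def truncMap (n : ℕ) :
    (Fin (n + 1) → A ⊗[K] Aᵐᵒᵖ) →ₗ[A ⊗[K] Aᵐᵒᵖ] (Fin (n + 1) → A ⊗[K] Aᵐᵒᵖ) :=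
  (LinearMap.toSpanSingleton (A ⊗[K] Aᵐᵒᵖ) (A ⊗[K] Aᵐᵒᵖ) (S.trunc n)).compLeft (Fin (n + 1))

theorem truncMap_apply (n : ℕ) (x : Fin (n + 1) → A ⊗[K] Aᵐᵒᵖ) (b : Fin (n + 1)) :
    S.truncMap n x b = x b * S.trunc n := rfl

theorem freeD_truncMap (n : ℕ) (x : Fin (n + 2) → A ⊗[K] Aᵐᵒᵖ) :
    S.freeD n (S.truncMap (n + 1) x) = S.truncMap n (S.freeD n x) := by
  ext1 b
  simp only [freeD_apply, truncMap_apply, add_mul, mul_assoc, trunc_succ_mul_dU,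
    trunc_succ_mul_dV]

/-- The modules of the Koszul bimodule resolution. -/
def koszul (n : ℕ) : Submodule (A ⊗[K] Aᵐᵒᵖ) (Fin (n + 1) → A ⊗[K] Aᵐᵒᵖ) :=
  LinearMap.eqLocus (S.truncMap n) LinearMap.id

theorem mem_koszul {n : ℕ} {x : Fin (n + 1) → A ⊗[K] Aᵐᵒᵖ} :
    x ∈ S.koszul n ↔ S.truncMap n x = x := Iff.rfl

theorem truncMap_mem_koszul (n : ℕ) (x : Fin (n + 1) → A ⊗[K] Aᵐᵒᵖ) :
    S.truncMap n x ∈ S.koszul n := by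
  rw [mem_koszul]
  ext1 b
  simp only [truncMap_apply, mul_assoc, trunc_mul_trunc]

instance (n : ℕ) : Module.Projective (A ⊗[K] Aᵐᵒᵖ) (S.koszul n) :=
  Module.Projective.of_split (S.koszul n).subtype
    ((S.truncMap n).codRestrict (S.koszul n) (S.truncMap_mem_koszul n))
    (LinearMap.ext fun x => Subtype.ext x.2)

/-- The differential of the Koszul bimodule resolution. -/
def koszulD (n : ℕ) : S.koszul (n + 1) →ₗ[A ⊗[K] Aᵐᵒᵖ] S.koszul n :=
  (S.freeD n).restrict fun x hx => by
    rw [mem_koszul] at hx ⊢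
    rw [← freeD_truncMap, hx]

theorem coe_koszulD (n : ℕ) (x : S.koszul (n + 1)) :
    (S.koszulD n x : Fin (n + 1) → A ⊗[K] Aᵐᵒᵖ) = S.freeD n x := rfl

theorem koszulD_koszulD (n : ℕ) (x : S.koszul (n + 2)) : S.koszulD n (S.koszulD (n + 1) x) = 0 :=
  Subtype.ext (S.freeD_freeD n x)

theorem exists_koszulD_eq {n : ℕ} {x : S.koszul (n + 1)} (hx : S.koszulD n x = 0) :
    ∃ y, S.koszulD (n + 1) y = x := by
  obtain ⟨y, hy⟩ := S.exists_freeD_eq (congrArg Subtype.val hx)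
  refine ⟨⟨_, S.truncMap_mem_koszul _ y⟩, Subtype.ext ?_⟩
  rw [coe_koszulD, freeD_truncMap, hy]
  exact x.2

/-- The augmentation of the Koszul bimodule resolution. -/
def augmentation : S.koszul 0 →ₗ[A ⊗[K] Aᵐᵒᵖ] A :=
  LinearMap.toSpanSingleton (A ⊗[K] Aᵐᵒᵖ) A 1 ∘ₗ LinearMap.proj 0 ∘ₗ (S.koszul 0).subtype

theorem augmentation_apply (x : S.koszul 0) : S.augmentation x = x.1 0 • (1 : A) := rfl

theorem trunc_zero_smul_one : S.trunc 0 • (1 : A) = 1 := by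
  simp [trunc, Finset.sum_smul, tmul_smul, S.e_mul_e, S.sum_e]

theorem augmentation_surjective : Function.Surjective S.augmentation := fun a => by
  refine ⟨⟨_, S.truncMap_mem_koszul 0 fun _ => a ⊗ₜ 1⟩, ?_⟩
  change (a ⊗ₜ 1 * S.trunc 0) • (1 : A) = a
  rw [mul_smul, trunc_zero_smul_one, tmul_smul, unop_one, mul_one, mul_one]

theorem augmentation_koszulD (x : S.koszul 1) : S.augmentation (S.koszulD 0 x) = 0 := by
  have dU_smul : S.dU 0 (0 : Fin 1) • (1 : A) = 0 := by
    simp [dU, add_smul, tmul_smul, smul_tensor_smul]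
  have dV_smul : S.dV 0 (0 : Fin 1) • (1 : A) = 0 := by
    simp [dV, add_smul, tmul_smul, smul_tensor_smul]
  rw [augmentation_apply, coe_koszulD, freeD_apply, add_smul, mul_smul, mul_smul, dU_smul,
    dV_smul, smul_zero, smul_zero, add_zero]

theorem IsReduced.eq_sum {x : Fin 1 → A ⊗[K] Aᵐᵒᵖ} (hx : S.IsReduced x) :
    x 0 = ∑ i, S.e i ⊗ₜ S.envCoord 0 (x 0) i := by
  refine S.eq_of_envCoord_eq fun m => funext fun i => ?_
  rw [map_sum, Finset.sum_apply]
  have h2 := (hx.1 0).1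
  have h3 := (hx.1 0).2
  fin_cases m <;> simp [envCoord_tmul, coord_e, Pi.single_apply, hx.2, h2, h3]

theorem IsReduced.truncMap_eq_zero {x : Fin 1 → A ⊗[K] Aᵐᵒᵖ} (hx : S.IsReduced x)
    (hx_aug : (x 0 * S.trunc 0) • (1 : A) = 0) : S.truncMap 0 x = 0 := by
  have e_mul (i : ZMod N) : S.e i * unop (S.envCoord 0 (x 0) i) = 0 := by
    rw [mul_smul, trunc_zero_smul_one, hx.eq_sum, Finset.sum_smul] at hx_aug
    simpa [tmul_smul, Finset.mul_sum, ← mul_assoc, S.e_mul_e] using congrArg (S.e i * ·) hx_aug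
  funext b
  rw [Fin.eq_zero b, truncMap_apply, hx.eq_sum, trunc, Finset.sum_mul]
  refine Finset.sum_eq_zero fun i _ => ?_
  rw [Finset.mul_sum, Finset.sum_eq_single i]
  · rw [Algebra.TensorProduct.tmul_mul_tmul, Nat.cast_zero, add_zero, ← op_unop (S.envCoord 0 _ i),
      ← op_mul, e_mul, op_zero, TensorProduct.tmul_zero]
  · intro j _ hj
    simp [S.e_mul_e, hj.symm]
  · simp

theorem exists_koszulD_zero_eq {x : S.koszul 0} (hx : S.augmentation x = 0) :
    ∃ y, S.koszulD 0 y = x := by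
  obtain ⟨y, hy⟩ := S.exists_isReduced_sub_freeD x.1
  let y' : S.koszul 1 := ⟨_, S.truncMap_mem_koszul 1 y⟩
  have trunc_sub : S.truncMap 0 (x.1 - S.freeD 0 y) = x - S.koszulD 0 y' := by
    rw [map_sub, coe_koszulD, freeD_truncMap, S.mem_koszul.1 x.2]
  have aug_sub : S.augmentation (x - S.koszulD 0 y') = 0 :=
    (map_sub S.augmentation x (S.koszulD 0 y')).trans <| by rw [hx, augmentation_koszulD, sub_zero]
  refine ⟨y', (Subtype.ext (sub_eq_zero.1 (trunc_sub.symm.trans (hy.truncMap_eq_zero S ?_)))).symm⟩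
  rw [← truncMap_apply, trunc_sub]
  exact aug_sub

end

end QuantumCover

namespace QuantumCover

noncomputable section

open MulOpposite CategoryTheory CategoryTheory.Abelian

attribute [local instance] instModuleTensorProductMop

/-! ### Hochschild cochains -/

section Cochains

variable {N : ℕ} [NeZero N] {K A : Type*} [Field K] [Ring A] [Algebra K A] {ρ : K}
  (S : QuantumCover N K A ρ)

theorem dU_smul (n b : ℕ) (z : A) :
    S.dU n b • z = ρ ^ b • (S.u * z) + (-1 : K) ^ (n + 1) • (z * S.u) := by
  rw [dU, add_smul, smul_tensor_smul, smul_tensor_smul, tmul_smul, tmul_smul, unop_one, unop_op,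
    mul_one, one_mul]

theorem dV_smul (n b : ℕ) (z : A) :
    S.dV n b • z = S.v * z + ((-1 : K) ^ (n + 1) * ρ ^ (n - b)) • (z * S.v) := by
  rw [dV, add_smul, smul_tensor_smul, tmul_smul, tmul_smul, unop_one, unop_op, mul_one, one_mul]

/-- The differential of the Hochschild cochains: a cochain of degree `n` lists its values on the
generators of `koszul n`. -/
def coD (n : ℕ) (m : Fin (n + 1) → A) : Fin (n + 2) → A :=
  (Fin.snoc (fun b : Fin (n + 1) => S.dU n b • m b) 0 : Fin (n + 2) → A) +
    (Fin.cons 0 (fun b : Fin (n + 1) => S.dV n b • m b) : Fin (n + 2) → A)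

theorem coD_apply (n : ℕ) (m : Fin (n + 1) → A) (c : Fin (n + 2)) : S.coD n m c =
    (Fin.snoc (fun b : Fin (n + 1) => S.dU n b • m b) 0 : Fin (n + 2) → A) c +
      (Fin.cons 0 (fun b : Fin (n + 1) => S.dV n b • m b) : Fin (n + 2) → A) c := rfl

/-- The cochains that come from morphisms on the Koszul resolution: all their values in degree `n`
go from a vertex `i` to the vertex `i + n`. -/
def IsHomog (n : ℕ) (m : Fin (n + 1) → A) : Prop := S.trunc n • m = m

theorem coD_trunc_smul (n : ℕ) (m : Fin (n + 1) → A) :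
    S.coD n (S.trunc n • m) = S.trunc (n + 1) • S.coD n m := by
  have dU_smul (b : ℕ) (z : A) : S.dU n b • S.trunc n • z = S.trunc (n + 1) • S.dU n b • z := by
    rw [← mul_smul, ← mul_smul, trunc_succ_mul_dU]
  have dV_smul (b : ℕ) (z : A) : S.dV n b • S.trunc n • z = S.trunc (n + 1) • S.dV n b • z := by
    rw [← mul_smul, ← mul_smul, trunc_succ_mul_dV]
  ext c
  rw [Pi.smul_apply, coD_apply, coD_apply, smul_add]
  congr 1
  · cases c using Fin.lastCases <;> simp [dU_smul]
  · cases c using Fin.cases <;> simp [dV_smul]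

variable {S} in
theorem IsHomog.coD {n : ℕ} {m : Fin (n + 1) → A} (hm : S.IsHomog n m) :
    S.IsHomog (n + 1) (S.coD n m) := by
  rw [IsHomog, ← coD_trunc_smul, hm]

theorem isHomog_trunc_smul (n : ℕ) (m : Fin (n + 1) → A) : S.IsHomog n (S.trunc n • m) := by
  ext b
  change S.trunc n • S.trunc n • m b = S.trunc n • m b
  rw [← mul_smul, trunc_mul_trunc]

/-- The morphism on the Koszul resolution with the given values on the generators. -/
def ofCochain (n : ℕ) (m : Fin (n + 1) → A) : S.koszul n →ₗ[A ⊗[K] Aᵐᵒᵖ] A where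
  toFun x := ∑ b, x.1 b • m b
  map_add' x y := by simp [add_smul, Finset.sum_add_distrib]
  map_smul' r x := by simp [mul_smul, Finset.smul_sum]

theorem ofCochain_apply (n : ℕ) (m : Fin (n + 1) → A) (x : S.koszul n) :
    S.ofCochain n m x = ∑ b, x.1 b • m b := rfl

theorem ofCochain_koszulD (n : ℕ) (m : Fin (n + 1) → A) (x : S.koszul (n + 1)) :
    S.ofCochain n m (S.koszulD n x) = S.ofCochain (n + 1) (S.coD n m) x := by
  simp only [ofCochain_apply, coe_koszulD, freeD_apply, coD_apply, smul_add,
    Finset.sum_add_distrib, add_smul, mul_smul]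
  congr 1
  · rw [Fin.sum_univ_castSucc (n := n + 1)]
    simp
  · rw [Fin.sum_univ_succ (n := n + 1)]
    simp

/-- The generators of the modules in the Koszul resolution. -/
def gen (n : ℕ) (b : Fin (n + 1)) : S.koszul n :=
  ⟨_, S.truncMap_mem_koszul n (Pi.single b 1)⟩

theorem coe_gen (n : ℕ) (b c : Fin (n + 1)) :
    (S.gen n b).1 c = if c = b then S.trunc n else 0 := by
  obtain rfl | h := eq_or_ne c b
  · simp [gen, truncMap_apply]
  · simp [gen, truncMap_apply, h]

theorem eq_sum_gen (n : ℕ) (x : S.koszul n) : x = ∑ b, x.1 b • S.gen n b := by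
  refine Subtype.ext (funext fun c => ?_)
  have hx : x.1 c * S.trunc n = x.1 c := congrFun x.2 c
  rw [AddSubmonoidClass.coe_finsetSum, Finset.sum_apply, Finset.sum_eq_single c]
  · simp [coe_gen, hx]
  · intro b _ hb
    simp [coe_gen, hb.symm]
  · simp

/-- The values of a morphism on the generators of the Koszul resolution. -/
def toCochain (n : ℕ) (f : S.koszul n →ₗ[A ⊗[K] Aᵐᵒᵖ] A) (b : Fin (n + 1)) : A := f (S.gen n b)

theorem ofCochain_toCochain (n : ℕ) (f : S.koszul n →ₗ[A ⊗[K] Aᵐᵒᵖ] A) :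
    S.ofCochain n (S.toCochain n f) = f := by
  ext x
  conv_rhs => rw [S.eq_sum_gen n x, map_sum]
  simp [ofCochain_apply, toCochain]

theorem isHomog_toCochain (n : ℕ) (f : S.koszul n →ₗ[A ⊗[K] Aᵐᵒᵖ] A) :
    S.IsHomog n (S.toCochain n f) := by
  ext b
  rw [Pi.smul_apply, toCochain, ← map_smul]
  congr 1
  refine Subtype.ext (funext fun c => ?_)
  rw [Submodule.coe_smul, Pi.smul_apply, coe_gen, smul_eq_mul, mul_ite, trunc_mul_trunc, mul_zero]

theorem toCochain_ofCochain {n : ℕ} {m : Fin (n + 1) → A} (hm : S.IsHomog n m) :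
    S.toCochain n (S.ofCochain n m) = m := by
  ext b
  rw [toCochain, ofCochain_apply, Finset.sum_eq_single b]
  · rw [coe_gen, if_pos rfl]
    exact congrFun hm b
  · intro c _ hc
    rw [coe_gen, if_neg hc, tensor_zero_smul]
  · simp

theorem toCochain_comp_koszulD (n : ℕ) (f : S.koszul n →ₗ[A ⊗[K] Aᵐᵒᵖ] A) :
    S.toCochain (n + 1) (f ∘ₗ S.koszulD n) = S.coD n (S.toCochain n f) := by
  rw [← S.toCochain_ofCochain (S.isHomog_toCochain n f).coD]
  congr 1
  ext x
  rw [← ofCochain_koszulD, ofCochain_toCochain, LinearMap.comp_apply]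

theorem toCochain_injective (n : ℕ) : Function.Injective (S.toCochain n) :=
  Function.LeftInverse.injective (S.ofCochain_toCochain n)

end Cochains

section Hochschild

variable {N : ℕ} [NeZero N] {K A : Type u} [Field K] [Ring A] [Algebra K A] {ρ : K}
  (S : QuantumCover N K A ρ)

/-- The Koszul bimodule resolution. -/
def resolution : ProjectiveResolution (ModuleCat.of (A ⊗[K] Aᵐᵒᵖ) A) :=
  projectiveResolutionOfExact (ModuleCat.of (A ⊗[K] Aᵐᵒᵖ) A)
    (fun n => ModuleCat.of (A ⊗[K] Aᵐᵒᵖ) (S.koszul n)) (fun n => ModuleCat.ofHom (S.koszulD n))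
    (ModuleCat.ofHom S.augmentation)
    (fun n => (IsProjective.iff_projective (S.koszul n)).1 inferInstance)
    (fun n => ModuleCat.hom_ext (LinearMap.ext (S.koszulD_koszulD n)))
    (ModuleCat.hom_ext (LinearMap.ext S.augmentation_koszulD))
    (fun _ _ => S.exists_koszulD_eq) (fun _ => S.exists_koszulD_zero_eq)
    S.augmentation_surjective

theorem resolution_d (n : ℕ) : S.resolution.complex.d (n + 1) n = ModuleCat.ofHom (S.koszulD n) :=
  ChainComplex.of_d (fun n => ModuleCat.of (A ⊗[K] Aᵐᵒᵖ) (S.koszul n))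
    (fun n => ModuleCat.ofHom (S.koszulD n)) n

/-- `toCochain` as a linear map on the morphisms from the Koszul resolution. -/
def cochainLinear (n : ℕ) :
    (S.resolution.complex.X n ⟶ ModuleCat.of (A ⊗[K] Aᵐᵒᵖ) A) →ₗ[K] (Fin (n + 1) → A) where
  toFun f := S.toCochain n f.hom
  map_add' f g := rfl
  map_smul' c f := by
    ext b
    change algebraMap K (A ⊗[K] Aᵐᵒᵖ) c • S.toCochain n f.hom b = c • S.toCochain n f.hom b
    rw [Algebra.algebraMap_eq_smul_one, smul_tensor_smul, one_smul]

theorem cochainLinear_injective (n : ℕ) : Function.Injective (S.cochainLinear n) := fun _ _ h =>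
  ModuleCat.hom_ext (S.toCochain_injective n h)

theorem cochainLinear_comp (n : ℕ)
    (f : S.resolution.complex.X n ⟶ ModuleCat.of (A ⊗[K] Aᵐᵒᵖ) A) :
    S.cochainLinear (n + 1) (S.resolution.complex.d (n + 1) n ≫ f) =
      S.coD n (S.cochainLinear n f) := by
  rw [resolution_d]
  exact S.toCochain_comp_koszulD n f.hom

theorem exists_cochainLinear_eq {n : ℕ} {m : Fin (n + 1) → A} (hm : S.IsHomog n m) :
    ∃ f, S.cochainLinear n f = m :=
  ⟨ModuleCat.ofHom (S.ofCochain n m), S.toCochain_ofCochain hm⟩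

theorem coD_cochainLinear_eq_zero {n : ℕ}
    {f : S.resolution.complex.X n ⟶ ModuleCat.of (A ⊗[K] Aᵐᵒᵖ) A} :
    S.coD n (S.cochainLinear n f) = 0 ↔ S.resolution.complex.d (n + 1) n ≫ f = 0 := by
  rw [← cochainLinear_comp, map_eq_zero_iff _ (S.cochainLinear_injective _)]

/-- The hypothesis on the coboundaries ignores homogeneity, because truncating a cochain of which a
homogeneous cochain is the coboundary does not change the latter. -/
theorem nonempty_hochschild_linearEquiv {n : ℕ} {V : Type*} [AddCommGroup V] [Module K V]
    (F : (Fin (n + 2) → A) →ₗ[K] V)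
    (surj : ∀ w, ∃ m, S.IsHomog (n + 1) m ∧ S.coD (n + 1) m = 0 ∧ F m = w)
    (ker : ∀ m, S.coD (n + 1) m = 0 → (F m = 0 ↔ ∃ g, S.coD n g = m)) :
    Nonempty (HochschildCohomology K A (n + 1) ≃ₗ[K] V) := by
  refine nonempty_ext_linearEquiv S.resolution (n := n) (F ∘ₗ S.cochainLinear (n + 1)) ?_ ?_
  · intro w
    obtain ⟨m, hm, h, hw⟩ := surj w
    obtain ⟨f, rfl⟩ := S.exists_cochainLinear_eq hm
    exact ⟨f, S.coD_cochainLinear_eq_zero.1 h, hw⟩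
  · intro f hf
    refine (ker _ (S.coD_cochainLinear_eq_zero.2 hf)).trans ⟨?_, ?_⟩
    · rintro ⟨g, hg⟩
      obtain ⟨g', hg'⟩ := S.exists_cochainLinear_eq (S.isHomog_trunc_smul n g)
      refine ⟨g', S.cochainLinear_injective _ ((S.cochainLinear_comp n g').trans ?_)⟩
      rw [hg', coD_trunc_smul, hg]
      exact S.isHomog_toCochain (n + 1) f.hom
    · rintro ⟨g, rfl⟩
      exact ⟨_, (S.cochainLinear_comp n g).symm⟩

end Hochschild

end

end QuantumCover

/-! ### Twisted differences on a cyclic group -/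

section TwistedDiff

variable {K : Type*} [Field K] {N : ℕ}

variable (N) in
/-- The operator `c σ - d` on the functions on a cyclic group, where `σ` is the cyclic shift. -/
noncomputable def twistedDiff (c d : K) : Module.End K (ZMod N → K) :=
  c • (cyclicShift K K N).toLinearMap - d • 1

theorem twistedDiff_apply (c d : K) (f : ZMod N → K) :
    twistedDiff N c d f = c • cyclicShift K K N f - d • f := rfl

theorem twistedDiff_mul_mul (k c d : K) (f : ZMod N → K) :
    twistedDiff N (k * c) (k * d) f = k • twistedDiff N c d f := by
  simp only [twistedDiff_apply, mul_smul, smul_sub]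

theorem twistedDiff_comm (a b c d : K) (f : ZMod N → K) :
    twistedDiff N a b (twistedDiff N c d f) = twistedDiff N c d (twistedDiff N a b f) := by
  simp only [twistedDiff_apply, map_sub, map_smul]
  module

theorem cyclicShift_pow_apply (n : ℕ) (f : ZMod N → K) (i : ZMod N) :
    ((cyclicShift K K N).toLinearMap ^ n) f i = f (i + n) := by
  induction n generalizing i with
  | zero => simp
  | succ n ih =>
    rw [pow_succ', Module.End.mul_apply, LinearEquiv.coe_coe, cyclicShift_apply, ih]
    push_cast
    ring_nf

theorem ne_zero_of_pow_injective {ρ : K} (hρ : Function.Injective fun n : ℕ => ρ ^ n) : ρ ≠ 0 := by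
  rintro rfl
  exact absurd (hρ (by simp : (0 : K) ^ 1 = 0 ^ 2)) (by simp)

/-- The Koszul complex of two commuting operators is exact in the middle when one of them is
invertible. -/
theorem exists_twistedDiff_eq_and {a b c d : K}
    (h : Function.Bijective (twistedDiff N a b) ∨ Function.Bijective (twistedDiff N c d))
    {p r : ZMod N → K} (hpr : twistedDiff N a b r = twistedDiff N c d p) :
    ∃ f, twistedDiff N a b f = p ∧ twistedDiff N c d f = r := by
  rcases h with h | h
  · obtain ⟨f, rfl⟩ := h.2 p
    exact ⟨f, rfl, h.1 (by rw [hpr, twistedDiff_comm])⟩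
  · obtain ⟨f, rfl⟩ := h.2 r
    exact ⟨f, h.1 (by rw [← hpr, twistedDiff_comm]), rfl⟩

variable [NeZero N]

theorem eq_const_of_twistedDiff_eq_zero {f : ZMod N → K}
    (hf : twistedDiff N 1 1 f = 0) (i : ZMod N) : f i = f 0 := by
  have periodic : Function.Periodic f 1 := fun j => by
    simpa [twistedDiff_apply, cyclicShift_apply, sub_eq_zero] using congrFun hf j
  rw [← ZMod.natCast_zmod_val i]
  simpa using periodic.nat_mul_eq i.val

theorem sum_twistedDiff_eq_zero (f : ZMod N → K) : ∑ i, twistedDiff N 1 1 f i = 0 := by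
  simp only [twistedDiff_apply, one_smul, Pi.sub_apply, Finset.sum_sub_distrib, cyclicShift_apply]
  exact sub_eq_zero.2 (Equiv.sum_comp (Equiv.addRight (1 : ZMod N)) f)

theorem exists_twistedDiff_eq_of_sum_eq_zero {g : ZMod N → K} (hg : ∑ i, g i = 0) :
    ∃ f, twistedDiff N 1 1 f = g := by
  let s (n : ℕ) : K := ∑ k ∈ Finset.range n, g k
  have s_self : s N = 0 := by
    rw [← hg]
    refine Finset.sum_bij (fun k _ => (k : ZMod N)) (by simp) (fun k hk l hl h => ?_)
      (fun i _ => ⟨i.val, by simp [ZMod.val_lt]⟩) (by simp)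
    rwa [ZMod.natCast_eq_natCast_iff', Nat.mod_eq_of_lt (Finset.mem_range.1 hk),
      Nat.mod_eq_of_lt (Finset.mem_range.1 hl)] at h
  have periodic : Function.Periodic s N := fun n => by
    rw [add_comm]
    simp only [s, Finset.sum_range_add, Nat.cast_add, ZMod.natCast_self, zero_add]
    simpa [s] using s_self
  refine ⟨fun i => s i.val, funext fun i => ?_⟩
  have s_succ : s (i + 1).val = s (i.val + 1) := by
    rw [ZMod.val_add, ZMod.val_one_eq_one_mod, Nat.add_mod_mod, periodic.map_mod_nat]
  simp [twistedDiff_apply, cyclicShift_apply, s_succ, s, Finset.sum_range_succ]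

theorem twistedDiff_bijective {c d : K} (h : c ^ N ≠ d ^ N) :
    Function.Bijective (twistedDiff N c d) := by
  have injective : Function.Injective (twistedDiff N c d) := by
    refine (injective_iff_map_eq_zero _).2 fun f hf => ?_
    have hcomm : Commute (c • (cyclicShift K K N).toLinearMap)
        (d • (1 : Module.End K (ZMod N → K))) :=
      (Commute.one_right _).smul_right d
    have hpow : (cyclicShift K K N).toLinearMap ^ N = 1 := by
      ext1 f
      ext i
      simp [cyclicShift_pow_apply]
    have hzero := LinearMap.congr_fun (hcomm.geom_sum₂_mul N) f
    rw [Module.End.mul_apply, ← twistedDiff, hf, map_zero, smul_pow, smul_pow, hpow, one_pow,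
      ← sub_smul] at hzero
    exact (smul_eq_zero.1 hzero.symm).resolve_left (sub_ne_zero.2 h)
  exact ⟨injective, LinearMap.injective_iff_surjective.1 injective⟩

theorem twistedDiff_pow_bijective {ρ : K} (hρ : Function.Injective fun n : ℕ => ρ ^ n) {i j : ℕ}
    (a : ℕ) (hij : i ≠ j) : Function.Bijective (twistedDiff N (ρ ^ i) ((-1) ^ a * ρ ^ j)) := by
  refine twistedDiff_bijective fun h => hij ?_
  have hsq : ρ ^ (i * (N * 2)) = ρ ^ (j * (N * 2)) := by
    rw [pow_mul, pow_mul (ρ ^ i), h, ← pow_mul, mul_pow, pow_right_comm,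
      Even.neg_one_pow (even_two.mul_left N), one_pow, one_mul, ← pow_mul]
  exact Nat.eq_of_mul_eq_mul_right (mul_pos (Nat.pos_of_ne_zero (NeZero.ne N)) two_pos) (hρ hsq)

/-- At every index a cocycle condition along `u v` is solvable through `u` or through `v`, with the
exception of the middle index in degree two, where the sum over the vertices is an obstruction. -/
theorem exists_twistedDiff_eq_or {ρ : K} (hρ : Function.Injective fun n : ℕ => ρ ^ n) {n : ℕ}
    (c : Fin (n + 2)) (w : ZMod N → K) (hw : n = 1 → c = 1 → ∑ i, w i = 0) :
    (∃ (b : Fin (n + 1)) (s : _), b.castSucc = c ∧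
        twistedDiff N (ρ ^ b.val) ((-1) ^ (n + 1) * ρ) s = w) ∨
      ∃ (b : Fin (n + 1)) (t : _), b.succ = c ∧
        twistedDiff N ρ ((-1) ^ (n + 1) * ρ ^ (n - b)) t = w := by
  have solve_u (b : Fin (n + 1)) (hb : b.val ≠ 1) :
      ∃ s, twistedDiff N (ρ ^ b.val) ((-1) ^ (n + 1) * ρ) s = w := by
    simpa using (twistedDiff_pow_bijective hρ (n + 1) hb).2 w
  have solve_v (b : Fin (n + 1)) (hb : n - b.val ≠ 1) :
      ∃ t, twistedDiff N ρ ((-1) ^ (n + 1) * ρ ^ (n - b)) t = w := by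
    simpa using (twistedDiff_pow_bijective hρ (n + 1) hb.symm).2 w
  cases c using Fin.lastCases with
  | last =>
    obtain ⟨t, ht⟩ := solve_v (Fin.last n) (by simp)
    exact .inr ⟨_, t, rfl, ht⟩
  | cast b =>
    by_cases hb : b.val = 1
    · obtain ⟨k, rfl⟩ : ∃ k, n = k + 1 := ⟨n - 1, by omega⟩
      by_cases hk : k = 0
      · subst hk
        obtain rfl : b = 1 := Fin.ext hb
        obtain ⟨s, hs⟩ := exists_twistedDiff_eq_of_sum_eq_zero (hw rfl rfl)
        refine .inl ⟨1, ρ⁻¹ • s, rfl, ?_⟩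
        have hscale := twistedDiff_mul_mul ρ 1 1 s
        rw [mul_one] at hscale
        simpa [hscale, smul_smul, ne_zero_of_pow_injective hρ] using hs
      · obtain ⟨t, ht⟩ := solve_v 0 (by simpa using hk)
        exact .inr ⟨0, t, Fin.ext hb.symm, ht⟩
    · obtain ⟨s, hs⟩ := solve_u b hb
      exact .inl ⟨b, s, rfl, hs⟩

end TwistedDiff

namespace QuantumCover

noncomputable section

open MulOpposite CategoryTheory CategoryTheory.Abelian

attribute [local instance] instModuleTensorProductMop

/-! ### The cohomology of the quantum cover -/

section Cohomology

variable {N : ℕ} [NeZero N] {K A : Type*} [Field K] [Ring A] [Algebra K A] {ρ : K}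
  (S : QuantumCover N K A ρ)

theorem exists_coord_eq (X : Fin 4 → ZMod N → K) : ∃ a, ∀ m, S.coord m a = X m :=
  ⟨S.basis.equivFun.symm fun p => X p.2 p.1, fun m => funext fun i =>
    congrFun (S.basis.equivFun.apply_symm_apply fun p => X p.2 p.1) (i, m)⟩

theorem coord_dU_smul (m : Fin 4) (n b : ℕ) (z : A) : S.coord m (S.dU n b • z) =
    (![0, twistedDiff N (ρ ^ b) ((-1) ^ n) (S.coord 0 z), 0,
      twistedDiff N (ρ ^ b) ((-1) ^ (n + 1) * ρ) (S.coord 2 z)] : Fin 4 → ZMod N → K) m := by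
  rw [dU_smul, map_add, map_smul, map_smul, coord_u_mul, coord_mul_u]
  fin_cases m <;> simp [twistedDiff_apply, pow_succ, mul_smul, sub_eq_add_neg]

theorem coord_dV_smul (m : Fin 4) (n b : ℕ) (z : A) : S.coord m (S.dV n b • z) =
    (![0, 0, twistedDiff N 1 ((-1) ^ n * ρ ^ (n - b)) (S.coord 0 z),
      -twistedDiff N ρ ((-1) ^ (n + 1) * ρ ^ (n - b)) (S.coord 1 z)] :
        Fin 4 → ZMod N → K) m := by
  rw [dV_smul, map_add, map_smul, coord_v_mul, coord_mul_v]
  fin_cases m <;> simp [twistedDiff_apply, pow_succ, mul_smul, sub_eq_add_neg, add_comm]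

theorem coord_coD (m : Fin 4) (n : ℕ) (x : Fin (n + 1) → A) (c : Fin (n + 2)) :
    S.coord m (S.coD n x c) =
      (![fun _ => 0,
        Fin.snoc (fun b : Fin (n + 1) => twistedDiff N (ρ ^ b.val) ((-1) ^ n) (S.coord 0 (x b))) 0,
        Fin.cons 0 fun b : Fin (n + 1) =>
          twistedDiff N 1 ((-1) ^ n * ρ ^ (n - b)) (S.coord 0 (x b)),
        (Fin.snoc (fun b : Fin (n + 1) =>
          twistedDiff N (ρ ^ b.val) ((-1) ^ (n + 1) * ρ) (S.coord 2 (x b))) 0 :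
            Fin (n + 2) → ZMod N → K) -
          (Fin.cons 0 fun b : Fin (n + 1) =>
            twistedDiff N ρ ((-1) ^ (n + 1) * ρ ^ (n - b)) (S.coord 1 (x b)) :
            Fin (n + 2) → ZMod N → K)] :
        Fin 4 → Fin (n + 2) → ZMod N → K) m c := by
  have hsnoc : S.coord m ((Fin.snoc (fun b => S.dU n b • x b) 0 : Fin (n + 2) → A) c) =
      (![fun _ => 0,
        Fin.snoc (fun b : Fin (n + 1) => twistedDiff N (ρ ^ b.val) ((-1) ^ n) (S.coord 0 (x b))) 0,
        fun _ => 0,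
        Fin.snoc (fun b : Fin (n + 1) =>
          twistedDiff N (ρ ^ b.val) ((-1) ^ (n + 1) * ρ) (S.coord 2 (x b))) 0] :
        Fin 4 → Fin (n + 2) → ZMod N → K) m c := by
    cases c using Fin.lastCases <;> fin_cases m <;> simp [coord_dU_smul]
  have hcons : S.coord m ((Fin.cons 0 fun b => S.dV n b • x b : Fin (n + 2) → A) c) =
      (![fun _ => 0, fun _ => 0,
        Fin.cons 0 fun b : Fin (n + 1) =>
          twistedDiff N 1 ((-1) ^ n * ρ ^ (n - b)) (S.coord 0 (x b)),
        -(Fin.cons 0 fun b : Fin (n + 1) =>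
          twistedDiff N ρ ((-1) ^ (n + 1) * ρ ^ (n - b)) (S.coord 1 (x b)) :
            Fin (n + 2) → ZMod N → K)] :
        Fin 4 → Fin (n + 2) → ZMod N → K) m c := by
    cases c using Fin.cases <;> fin_cases m <;> simp [coord_dV_smul]
  rw [coD_apply, map_add, hsnoc, hcons]
  fin_cases m <;> simp [sub_eq_add_neg]

theorem coord_three_coD_succ_castSucc {n : ℕ} (x : Fin (n + 2) → A) (b : Fin (n + 1)) :
    S.coord 3 (S.coD (n + 1) x b.succ.castSucc) =
      twistedDiff N (ρ ^ (b.val + 1)) ((-1) ^ (n + 2) * ρ) (S.coord 2 (x b.succ)) -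
        twistedDiff N ρ ((-1) ^ (n + 2) * ρ ^ (n + 1 - b)) (S.coord 1 (x b.castSucc)) := by
  rw [coD_apply, Fin.snoc_castSucc, ← Fin.succ_castSucc, Fin.cons_succ, map_add, coord_dU_smul,
    coord_dV_smul]
  simp [sub_eq_add_neg]

theorem coD_add (n : ℕ) (x y : Fin (n + 1) → A) : S.coD n (x + y) = S.coD n x + S.coD n y := by
  ext c
  simp only [Pi.add_apply, coD_apply]
  rw [add_add_add_comm]
  congr 1
  · cases c using Fin.lastCases <;> simp
  · cases c using Fin.cases <;> simp

variable {S} in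
theorem coord_zero_eq_zero_of_coD_eq_zero (hρ : Function.Injective fun n : ℕ => ρ ^ n) {n : ℕ}
    {x : Fin (n + 2) → A} (hx : S.coD (n + 1) x = 0) (b : Fin (n + 2)) : S.coord 0 (x b) = 0 := by
  by_cases hb : b = 0
  · subst hb
    refine (map_eq_zero_iff _ (twistedDiff_pow_bijective (N := N) hρ (n + 1)
      (Nat.zero_ne_add_one n)).1).1 ?_
    simpa [hx] using (S.coord_coD 2 (n + 1) x 1).symm
  · refine (map_eq_zero_iff _ (twistedDiff_pow_bijective (N := N) hρ (n + 1)
      (Fin.val_ne_zero_iff.2 hb)).1).1 ?_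
    simpa [hx] using (S.coord_coD 1 (n + 1) x b.castSucc).symm

theorem exists_coord_coD_three_eq (hρ : Function.Injective fun n : ℕ => ρ ^ n) {n : ℕ}
    (w : Fin (n + 2) → ZMod N → K) (hw : n = 1 → ∑ i, w 1 i = 0) :
    ∃ g, ∀ c m, S.coord m (S.coD n g c) = (![0, 0, 0, w c] : Fin 4 → ZMod N → K) m := by
  have solve (c : Fin (n + 2)) : ∃ s t : ZMod N → K,
      (Fin.snoc (fun b : Fin (n + 1) => twistedDiff N (ρ ^ b.val) ((-1) ^ (n + 1) * ρ) s) 0 :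
          Fin (n + 2) → ZMod N → K) c -
        (Fin.cons 0 fun b : Fin (n + 1) => twistedDiff N ρ ((-1) ^ (n + 1) * ρ ^ (n - b)) t :
          Fin (n + 2) → ZMod N → K) c = w c := by
    rcases exists_twistedDiff_eq_or hρ c (w c) fun hn hc => hc ▸ hw hn with
      ⟨b, s, rfl, hs⟩ | ⟨b, t, rfl, ht⟩
    · refine ⟨s, 0, ?_⟩
      rw [Fin.snoc_castSucc, hs, sub_eq_self]
      cases b.castSucc using Fin.cases <;> simp
    · refine ⟨0, -t, ?_⟩
      rw [Fin.cons_succ, map_neg, ht, sub_neg_eq_add, add_eq_right]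
      cases b.succ using Fin.lastCases <;> simp
  choose s t hst using solve
  choose g hg using S.exists_coord_eq
  refine ⟨fun b => g ![0, t b.succ, s b.castSucc, 0], fun c m => ?_⟩
  rw [coord_coD]
  fin_cases m
  · rfl
  · cases c using Fin.lastCases <;> simp [hg]
  · cases c using Fin.cases <;> simp [hg]
  · refine (congrArg₂ (· - ·) ?_ ?_).trans (hst c)
    · cases c using Fin.lastCases <;> simp [hg]
    · cases c using Fin.cases <;> simp [hg]

variable {S} in
theorem exists_coord_coD_one_two_eq (hρ : Function.Injective fun n : ℕ => ρ ^ n) {n : ℕ}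
    {x : Fin (n + 2) → A} (hx : S.coD (n + 1) x = 0)
    (hx₀ : n = 0 → ∑ i, S.coord 1 (x 0) i = 0 ∧ S.coord 2 (x 1) = S.coord 1 (x 0)) :
    ∃ g, ∀ c, S.coord 1 (S.coD n g c) = S.coord 1 (x c) ∧
      S.coord 2 (S.coD n g c) = S.coord 2 (x c) := by
  have hρ₀ := ne_zero_of_pow_injective hρ
  have coord_two_zero : S.coord 2 (x 0) = 0 := by
    refine (map_eq_zero_iff _ (twistedDiff_pow_bijective (N := N) hρ n zero_ne_one).1).1 ?_
    simpa [hx, pow_succ] using (S.coord_coD 3 (n + 1) x 0).symm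
  have coord_one_last : S.coord 1 (x (Fin.last _)) = 0 := by
    refine (map_eq_zero_iff _ (twistedDiff_pow_bijective (N := N) hρ n one_ne_zero).1).1 ?_
    simpa [hx, pow_succ] using (S.coord_coD 3 (n + 1) x (Fin.last _)).symm
  have solve (b : Fin (n + 1)) : ∃ z : ZMod N → K,
      twistedDiff N (ρ ^ b.val) ((-1) ^ n) z = S.coord 1 (x b.castSucc) ∧
        twistedDiff N 1 ((-1) ^ n * ρ ^ (n - b)) z = S.coord 2 (x b.succ) := by
    by_cases h : n = 0
    · subst h
      obtain rfl : b = 0 := Fin.fin_one_eq_zero b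
      obtain ⟨z, hz⟩ := exists_twistedDiff_eq_of_sum_eq_zero (hx₀ rfl).1
      exact ⟨z, by simpa using hz, by simpa [hz] using (hx₀ rfl).2.symm⟩
    · have hcocycle : twistedDiff N (ρ ^ b.val) ((-1) ^ n) (S.coord 2 (x b.succ)) =
          twistedDiff N 1 ((-1) ^ n * ρ ^ (n - b)) (S.coord 1 (x b.castSucc)) := by
        have h := S.coord_three_coD_succ_castSucc x b
        rw [hx, Pi.zero_apply, map_zero, eq_comm, sub_eq_zero] at h
        refine smul_right_injective _ hρ₀ ?_
        simp only [← twistedDiff_mul_mul]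
        convert h using 2
        · congr 1 <;> ring
        · rw [Nat.sub_add_comm (by omega)]
          congr 1 <;> ring
      refine exists_twistedDiff_eq_and ?_ hcocycle
      by_cases hb : b.val = 0
      · right
        simpa using twistedDiff_pow_bijective hρ n (i := 0) (j := n - b) (by omega)
      · left
        simpa using twistedDiff_pow_bijective hρ n (i := b) (j := 0) hb
  choose z hz₁ hz₂ using solve
  choose g hg using S.exists_coord_eq
  refine ⟨fun b => g ![z b, 0, 0, 0], fun c => ⟨?_, ?_⟩⟩
  · rw [coord_coD]
    cases c using Fin.lastCases with
    | last => simp [coord_one_last]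
    | cast b => simp [hg, hz₁]
  · rw [coord_coD]
    cases c using Fin.cases with
    | zero => simp [coord_two_zero]
    | succ b => simp [hg, hz₂]

theorem coD_zero_coord (x : Fin 1 → A) : ∑ i, S.coord 1 (S.coD 0 x 0) i = 0 ∧
    S.coord 2 (S.coD 0 x 1) = S.coord 1 (S.coD 0 x 0) := by
  have h₁ : S.coord 1 (S.coD 0 x 0) = twistedDiff N 1 1 (S.coord 0 (x 0)) := by
    simpa using S.coord_coD 1 0 x (Fin.castSucc 0)
  have h₂ : S.coord 2 (S.coD 0 x 1) = twistedDiff N 1 1 (S.coord 0 (x 0)) := by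
    simpa using S.coord_coD 2 0 x (Fin.succ 0)
  rw [h₁, h₂]
  exact ⟨sum_twistedDiff_eq_zero _, rfl⟩

theorem coord_three_coD_one (x : Fin 2 → A) : S.coord 3 (S.coD 1 x 1) =
    ρ • twistedDiff N 1 1 (S.coord 2 (x 1) - S.coord 1 (x 0)) := by
  rw [← twistedDiff_mul_mul, map_sub]
  simpa using S.coord_three_coD_succ_castSucc x 0

theorem sum_coord_three_coD_one (x : Fin 2 → A) : ∑ i, S.coord 3 (S.coD 1 x 1) i = 0 := by
  rw [coord_three_coD_one, ← map_smul]
  exact sum_twistedDiff_eq_zero _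

theorem exists_coD_eq (hρ : Function.Injective fun n : ℕ => ρ ^ n) {n : ℕ} {x : Fin (n + 2) → A}
    (hx : S.coD (n + 1) x = 0)
    (hx₀ : n = 0 → ∑ i, S.coord 1 (x 0) i = 0 ∧ S.coord 2 (x 1) = S.coord 1 (x 0))
    (hx₁ : n = 1 → ∑ i, S.coord 3 (x 1) i = 0) : ∃ g, S.coD n g = x := by
  obtain ⟨g, hg⟩ := exists_coord_coD_one_two_eq hρ hx hx₀
  obtain ⟨g', hg'⟩ := S.exists_coord_coD_three_eq hρ
    (fun c => S.coord 3 (x c) - S.coord 3 (S.coD n g c)) fun hn => by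
      subst hn
      simp [hx₁ rfl, sum_coord_three_coD_one]
  refine ⟨g + g', funext fun c => S.eq_of_coord_eq fun m => ?_⟩
  have h₀ : S.coord 0 (S.coD n g c) = 0 := S.coord_coD 0 n g c
  rw [coD_add, Pi.add_apply, map_add, hg']
  fin_cases m
  · simp [h₀, coord_zero_eq_zero_of_coD_eq_zero hρ hx]
  · simp [hg]
  · simp [hg]
  · simp

theorem coord_one (m : Fin 4) : S.coord m 1 = if m = 0 then 1 else 0 := by
  rw [← S.sum_e, map_sum]
  simp only [coord_e]
  split_ifs
  · exact Finset.univ_sum_single 1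
  · exact Finset.sum_const_zero

theorem coord_two_v : S.coord 2 S.v = 1 := by
  rw [← one_mul S.v, coord_mul_v]
  exact S.coord_one 0

theorem coD_one (x : Fin 2 → A) : S.coD 1 x =
    ![S.dU 1 0 • x 0, S.dU 1 1 • x 1 + S.dV 1 0 • x 0, S.dV 1 1 • x 1] := by
  funext c
  fin_cases c
  exacts [add_zero _, rfl, zero_add _]

theorem coD_two (x : Fin 3 → A) : S.coD 2 x =
    ![S.dU 2 0 • x 0, S.dU 2 1 • x 1 + S.dV 2 0 • x 0, S.dU 2 2 • x 2 + S.dV 2 1 • x 1,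
      S.dV 2 2 • x 2] := by
  funext c
  fin_cases c
  exacts [add_zero _, rfl, rfl, zero_add _]

theorem e_mul_e_mul_eq {n : ℕ} {a : A} (h : ∀ i, S.e i * a = a * S.e (i + n)) (j i : ZMod N) :
    S.e i * (S.e j * a) = S.e j * a * S.e (i + n) := by
  have e_comm : S.e i * S.e j = S.e j * S.e i := by
    rw [S.e_mul_e, S.e_mul_e]
    split_ifs <;> simp_all
  rw [← mul_assoc, e_comm, mul_assoc, mul_assoc, h]

theorem isHomog_of_e_mul_eq {n : ℕ} {m : Fin (n + 1) → A}
    (h : ∀ b i, S.e i * m b = m b * S.e (i + n)) : S.IsHomog n m := by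
  funext b
  change S.trunc n • m b = m b
  have key (i : ZMod N) : (S.e i ⊗ₜ[K] op (S.e (i + n))) • m b = S.e i * m b := by
    rw [tmul_smul, unop_op, mul_assoc, ← h, ← mul_assoc, S.e_mul_e, if_pos rfl]
  rw [trunc, Finset.sum_smul, Finset.sum_congr rfl fun i _ => key i, ← Finset.sum_mul, S.sum_e,
    one_mul]

end Cohomology

section Hochschild

variable {N : ℕ} [NeZero N] {K A : Type u} [Field K] [Ring A] [Algebra K A] {ρ : K}

/-- A first cohomology class is determined by the weights that it gives to a cycle of arrows `u`
and to a single pair of parallel arrows `v` and `u`. -/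
theorem nonempty_hochschild_one_linearEquiv (S : QuantumCover N K A ρ)
    (hρ : Function.Injective fun n : ℕ => ρ ^ n) :
    Nonempty (HochschildCohomology K A 1 ≃ₗ[K] K × K) := by
  let F : (Fin 2 → A) →ₗ[K] K × K :=
    LinearMap.prod (∑ i, LinearMap.proj i ∘ₗ S.coord 1 ∘ₗ LinearMap.proj 0)
      (LinearMap.proj 0 ∘ₗ (S.coord 2 ∘ₗ LinearMap.proj 1 - S.coord 1 ∘ₗ LinearMap.proj 0))
  have F_apply (m : Fin 2 → A) :
      F m = (∑ i, S.coord 1 (m 0) i, S.coord 2 (m 1) 0 - S.coord 1 (m 0) 0) := by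
    simp [F]
  refine S.nonempty_hochschild_linearEquiv F (fun w => ?_) fun m hm => ?_
  · refine ⟨![w.1 • (S.e 0 * S.u), w.1 • (S.e 0 * S.v) + w.2 • S.v], ?_, ?_, ?_⟩
    · refine S.isHomog_of_e_mul_eq fun b i => ?_
      have hu := S.e_mul_e_mul_eq (n := 1) (a := S.u) (by simpa using S.e_mul_u) 0 i
      have hv := S.e_mul_e_mul_eq (n := 1) (a := S.v) (by simpa using S.e_mul_v) 0 i
      have hv' : S.e i * S.v = S.v * S.e (i + (1 : ℕ)) := by simpa using S.e_mul_v i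
      fin_cases b
      · simp [hu]
      · simp [mul_add, add_mul, hv, hv']
    · rw [coD_one]
      funext c
      fin_cases c
      · simp [dU_smul, S.u_mul_e_mul, mul_assoc, S.u_mul_u]
      · simp [dU_smul, dV_smul, S.u_mul_e_mul, S.v_mul_e_mul, mul_assoc, S.v_mul_u]
        module
      · simp [dV_smul, S.v_mul_e_mul, mul_assoc, S.v_mul_v]
    · simp [F_apply, coord_e_mul_u, coord_e_mul_v, coord_two_v, ← Finset.mul_sum]
  · rw [F_apply, Prod.mk_eq_zero]
    refine ⟨fun h => ?_, ?_⟩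
    · refine S.exists_coD_eq hρ hm (fun _ => ⟨h.1, ?_⟩) (by simp)
      have hdiff := S.coord_three_coD_one m
      rw [hm, Pi.zero_apply, map_zero, eq_comm,
        smul_eq_zero_iff_right (ne_zero_of_pow_injective hρ)] at hdiff
      exact sub_eq_zero.1 (funext fun i => (eq_const_of_twistedDiff_eq_zero hdiff i).trans h.2)
    · rintro ⟨g, rfl⟩
      obtain ⟨h₁, h₂⟩ := S.coD_zero_coord g
      exact ⟨h₁, by rw [h₂, sub_self]⟩

theorem nonempty_hochschild_two_linearEquiv (S : QuantumCover N K A ρ)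
    (hρ : Function.Injective fun n : ℕ => ρ ^ n) :
    Nonempty (HochschildCohomology K A 2 ≃ₗ[K] K) := by
  let F : (Fin 3 → A) →ₗ[K] K := ∑ i, LinearMap.proj i ∘ₗ S.coord 3 ∘ₗ LinearMap.proj 1
  have F_apply (m : Fin 3 → A) : F m = ∑ i, S.coord 3 (m 1) i := by simp [F]
  refine S.nonempty_hochschild_linearEquiv F (fun w => ?_) fun m hm => ?_
  · have u_mul_v_mul_u : S.u * (S.v * S.u) = 0 := by rw [← mul_assoc, S.u_mul_v_mul_u]
    refine ⟨![0, w • (S.e 0 * (S.u * S.v)), 0], S.isHomog_of_e_mul_eq fun b i => ?_, ?_, ?_⟩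
    · have huv := S.e_mul_e_mul_eq (n := 2) (a := S.u * S.v) (fun i => by
        rw [← mul_assoc, S.e_mul_u, mul_assoc, S.e_mul_v, ← mul_assoc, add_assoc,
          one_add_one_eq_two, Nat.cast_ofNat]) 0 i
      fin_cases b <;> simp [huv]
    · rw [coD_two]
      funext c
      fin_cases c
      · simp [dU_smul]
      · simp [dU_smul, dV_smul, S.u_mul_e_mul, mul_assoc, S.u_mul_u_mul_v, u_mul_v_mul_u]
      · simp [dU_smul, dV_smul, S.v_mul_e_mul, mul_assoc, S.v_mul_u_mul_v, S.v_mul_v]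
      · simp [dV_smul]
    · simp [F_apply, coord_e_mul_u_mul_v, ← Finset.mul_sum]
  · rw [F_apply]
    refine ⟨fun h => S.exists_coD_eq hρ hm (by simp) fun _ => h, ?_⟩
    rintro ⟨g, rfl⟩
    exact S.sum_coord_three_coD_one g

theorem hochschild_subsingleton (S : QuantumCover N K A ρ)
    (hρ : Function.Injective fun n : ℕ => ρ ^ n) (n : ℕ) :
    Subsingleton (HochschildCohomology K A (n + 3)) := by
  obtain ⟨φ⟩ := S.nonempty_hochschild_linearEquiv (n := n + 2) (V := PUnit.{u + 1}) 0
    (fun w => ⟨0, S.isHomog_of_e_mul_eq (by simp), by simpa using S.coD_add (n + 3) 0 0, rfl⟩)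
    fun m hm => iff_of_true rfl (S.exists_coD_eq hρ hm (by simp) (by simp))
  exact φ.toEquiv.subsingleton

end Hochschild

end

end QuantumCover

namespace QuantumCover

noncomputable section

open MulOpposite CategoryTheory CategoryTheory.Abelian

attribute [local instance] instModuleTensorProductMop

section Center

variable {N : ℕ} [NeZero N] {K A : Type*} [Field K] [Ring A] [Algebra K A] {ρ : K}
  (S : QuantumCover N K A ρ)

theorem coord_e_mul (m : Fin 4) (i : ZMod N) (a : A) :
    S.coord m (S.e i * a) = Pi.single i (S.coord m a i) := by
  have key : S.coord m ∘ₗ LinearMap.mulLeft K (S.e i) =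
      LinearMap.single K _ i ∘ₗ LinearMap.proj i ∘ₗ S.coord m := by
    refine S.basis.ext fun ⟨j, m'⟩ => ?_
    have hij : S.e i * S.basis (j, m') = if i = j then S.basis (j, m') else 0 := by
      rw [S.basis_apply, ← mul_assoc, S.e_mul_e]
      split_ifs with h
      · rw [h]
      · rw [zero_mul]
    simp only [LinearMap.comp_apply, LinearMap.mulLeft_apply, LinearMap.coe_single,
      LinearMap.proj_apply, hij, apply_ite (S.coord m), map_zero, coord_basis]
    split_ifs <;> simp_all [eq_comm]
  exact LinearMap.congr_fun key a

theorem basis_mul_e (m : Fin 4) (i j : ZMod N) : S.basis (i, m) * S.e j =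
    if i + (![0, 1, 1, 2] : Fin 4 → ZMod N) m = j then S.basis (i, m) else 0 := by
  rw [← sub_add_cancel j (![0, 1, 1, 2] m)]
  have mul_e : (![1, S.u, S.v, S.u * S.v] : Fin 4 → A) m *
        S.e (j - ![0, 1, 1, 2] m + ![0, 1, 1, 2] m) =
      S.e (j - ![0, 1, 1, 2] m) * (![1, S.u, S.v, S.u * S.v] : Fin 4 → A) m := by
    fin_cases m
    · simp
    · simp [u_mul_e]
    · simp [v_mul_e]
    · simp [mul_assoc, v_mul_e, u_mul_e_mul, sub_sub, one_add_one_eq_two]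
  rw [S.basis_apply, mul_assoc, mul_e, ← mul_assoc, S.e_mul_e]
  simp only [ite_mul, zero_mul, add_left_inj]

theorem coord_mul_e_of_ne {m : Fin 4} {i j : ZMod N} (a : A)
    (h : i + (![0, 1, 1, 2] : Fin 4 → ZMod N) m ≠ j) : S.coord m (a * S.e j) i = 0 := by
  have key : LinearMap.proj i ∘ₗ S.coord m ∘ₗ LinearMap.mulRight K (S.e j) = 0 := by
    refine S.basis.ext fun ⟨k, m'⟩ => ?_
    simp only [LinearMap.comp_apply, LinearMap.mulRight_apply, LinearMap.proj_apply, basis_mul_e,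
      LinearMap.zero_apply]
    split_ifs with hk
    · rw [coord_basis]
      split_ifs with hm
      · subst hm
        exact Pi.single_eq_of_ne (fun hik => h (by rwa [hik])) 1
      · rfl
    · rw [map_zero, Pi.zero_apply]
  exact LinearMap.congr_fun key a

theorem exists_eq_smul_one_of_central (S : QuantumCover N K A ρ) (hN : 3 ≤ N) {z : A}
    (hz : ∀ a, a * z = z * a) : ∃ c : K, z = c • 1 := by
  have degree_ne_zero (m : Fin 4) (hm : m ≠ 0) : (![0, 1, 1, 2] : Fin 4 → ZMod N) m ≠ 0 := by
    have natCast_ne_zero (k : ℕ) (hk : 0 < k) (hkN : k < N) : (k : ZMod N) ≠ 0 := fun h =>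
      hkN.not_ge (Nat.le_of_dvd hk ((ZMod.natCast_eq_zero_iff k N).1 h))
    have h₁ : (1 : ZMod N) ≠ 0 := by exact_mod_cast natCast_ne_zero 1 (by lia) (by lia)
    have h₂ : (2 : ZMod N) ≠ 0 := by exact_mod_cast natCast_ne_zero 2 (by lia) (by lia)
    fin_cases m <;> simp_all
  have coord_eq_zero (m : Fin 4) (hm : m ≠ 0) : S.coord m z = 0 := funext fun i => by
    rw [← Pi.single_eq_same (M := fun _ : ZMod N => K) i (S.coord m z i), ← S.coord_e_mul, hz]
    exact S.coord_mul_e_of_ne z (by simpa using degree_ne_zero m hm)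
  have coord_zero_eq (i : ZMod N) : S.coord 0 z i = S.coord 0 z 0 := by
    refine eq_const_of_twistedDiff_eq_zero ?_ i
    rw [twistedDiff_apply, one_smul, one_smul, sub_eq_zero]
    simpa [coord_u_mul, coord_mul_u] using congrArg (S.coord 1) (hz S.u)
  refine ⟨S.coord 0 z 0, S.eq_of_coord_eq fun m => ?_⟩
  rw [map_smul, coord_one]
  split_ifs with hm
  · subst hm
    exact funext fun i => by rw [coord_zero_eq, Pi.smul_apply, Pi.one_apply, smul_eq_mul, mul_one]
  · rw [coord_eq_zero m hm, smul_zero]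

end Center

section Hochschild

variable {N : ℕ} [NeZero N] {K A : Type u} [Field K] [Ring A] [Algebra K A] {ρ : K}

theorem exists_eq_smul_unit (S : QuantumCover N K A ρ) (hN : 3 ≤ N)
    (α : HochschildCohomology K A 0) : ∃ c : K, α = c • HochschildCohomology.unit K A := by
  obtain ⟨f, rfl⟩ := (Ext.mk₀_bijective (regularBimodule K A) (regularBimodule K A)).2 α
  let φ : A →ₗ[A ⊗[K] Aᵐᵒᵖ] A := f.hom
  have apply_eq_mul (a : A) : φ a = a * φ 1 := by
    rw [← mul_one (a * φ 1), ← unop_one, ← tmul_smul (K := K), ← map_smul, tmul_smul]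
    simp
  have apply_eq_mul' (a : A) : φ a = φ 1 * a := by
    rw [← one_mul (φ 1), ← unop_op a, ← tmul_smul (K := K), ← map_smul, tmul_smul]
    simp
  obtain ⟨c, hc⟩ := S.exists_eq_smul_one_of_central hN (z := φ 1) fun a =>
    (apply_eq_mul a).symm.trans (apply_eq_mul' a)
  refine ⟨c, ?_⟩
  have apply_eq_smul (a : A) : φ a = algebraMap K (A ⊗[K] Aᵐᵒᵖ) c • a := by
    rw [apply_eq_mul, hc, Algebra.algebraMap_eq_smul_one, smul_tensor_smul, one_smul, mul_smul_comm,
      mul_one]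
  have f_eq : f = c • 𝟙 (regularBimodule K A) :=
    ModuleCat.hom_ext (LinearMap.ext apply_eq_smul)
  rw [f_eq]
  exact Ext.mk₀_smul c _

theorem unit_ne_zero [Nontrivial A] : HochschildCohomology.unit K A ≠ 0 := fun h =>
  one_ne_zero (α := A) <| congrArg
    (fun f : regularBimodule K A ⟶ regularBimodule K A => f.hom (1 : A))
    ((Ext.mk₀_eq_zero_iff _).1 h)

end Hochschild

end

end QuantumCover

/-- A graded `K`-algebra `⨁ n, 𝒜 n` is *connected* when the structure map identifies `K` with its
part of degree `0`. -/
def IsConnectedGraded (K : Type*) [Field K] (𝒜 : ℕ → Type*) [∀ n, AddCommGroup (𝒜 n)]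
    [∀ n, Module K (𝒜 n)] [DirectSum.GRing 𝒜] [DirectSum.GAlgebra K 𝒜] : Prop :=
  Function.Bijective (DirectSum.GAlgebra.toFun : K → 𝒜 0)

section Graded

open DirectSum

variable {𝒜 : ℕ → Type*} [∀ n, AddCommGroup (𝒜 n)]

theorem directSum_mul_apply_eq_zero [GRing 𝒜] {m n : ℕ} {x y : ⨁ k, 𝒜 k}
    (hx : ∀ i < m, x i = 0) (hy : ∀ j < n, y j = 0) : ∀ k < m + n, (x * y) k = 0 := by
  classical
  intro k hk
  rw [mul_eq_sum_support_ghas_mul, DirectSum.sum_apply]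
  refine Finset.sum_eq_zero fun ij hij => of_eq_of_ne _ _ _ fun h => ?_
  obtain ⟨hi, hj⟩ := Finset.mem_product.1 hij
  have hmi : m ≤ ij.1 := not_lt.1 fun h => (DFinsupp.mem_support_iff.1 hi) (hx _ h)
  have hnj : n ≤ ij.2 := not_lt.1 fun h => (DFinsupp.mem_support_iff.1 hj) (hy _ h)
  lia

theorem isNilpotent_of_apply_zero_eq_zero [GRing 𝒜] {d : ℕ}
    (vanish : ∀ n, d ≤ n → Subsingleton (𝒜 n)) {x : ⨁ n, 𝒜 n} (hx : x 0 = 0) : IsNilpotent x := by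
  have pow_apply_eq_zero (n : ℕ) : ∀ k < n, (x ^ n) k = 0 := by
    induction n with
    | zero => simp
    | succ n ih =>
      rw [pow_succ]
      exact directSum_mul_apply_eq_zero ih fun j hj => by rwa [Nat.lt_one_iff.1 hj]
  refine ⟨d, DirectSum.ext fun k => ?_⟩
  obtain hk | hk := lt_or_ge k d
  · exact pow_apply_eq_zero d k hk
  · exact (vanish k hk).elim _ _

theorem finrank_directSum_eq_sum_range {K : Type*} [Field K] [∀ n, Module K (𝒜 n)]
    [∀ n, Module.Finite K (𝒜 n)] {d : ℕ} (vanish : ∀ n, d ≤ n → Subsingleton (𝒜 n)) :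
    Module.finrank K (⨁ n, 𝒜 n) = ∑ n ∈ Finset.range d, Module.finrank K (𝒜 n) := by
  let restrict : (⨁ n, 𝒜 n) →ₗ[K] Π i : Fin d, 𝒜 i :=
    LinearMap.pi fun i => DirectSum.component K ℕ 𝒜 i
  have restrict_bijective : Function.Bijective restrict := by
    constructor
    · refine (injective_iff_map_eq_zero _).2 fun x hx => DirectSum.ext fun n => ?_
      obtain hn | hn := lt_or_ge n d
      · exact congrFun hx ⟨n, hn⟩
      · exact (vanish n hn).elim _ _
    · intro y
      refine ⟨∑ i : Fin d, of 𝒜 i (y i), funext fun i => ?_⟩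
      change (∑ i : Fin d, of 𝒜 i (y i)) i = y i
      rw [DirectSum.sum_apply, Finset.sum_eq_single i
        (fun j _ hj => of_eq_of_ne _ _ _ (Fin.val_ne_of_ne hj.symm)) (by simp), of_eq_same]
  rw [(LinearEquiv.ofBijective restrict restrict_bijective).finrank_eq,
    Module.finrank_pi_fintype, Fin.sum_univ_eq_sum_range fun n => Module.finrank K (𝒜 n)]

end Graded

namespace IsConnectedGraded

open DirectSum

variable {K : Type*} [Field K] {𝒜 : ℕ → Type*} [∀ n, AddCommGroup (𝒜 n)] [∀ n, Module K (𝒜 n)]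
  [GRing 𝒜] [GAlgebra K 𝒜]

theorem exists_augmentation (h : IsConnectedGraded K 𝒜) :
    ∃ ε : (⨁ n, 𝒜 n) →ₐ[K] K, ∀ x c, ε x = c ↔ (x - algebraMap K _ c) 0 = 0 := by
  let ε (x : ⨁ n, 𝒜 n) : K := (Equiv.ofBijective _ h).symm (x 0)
  have eq_iff (x : ⨁ n, 𝒜 n) (c : K) : ε x = c ↔ (x - algebraMap K _ c) 0 = 0 := by
    rw [DirectSum.sub_apply, DirectSum.algebraMap_apply, of_eq_same, sub_eq_zero]
    exact Equiv.symm_apply_eq _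
  have spec (x : ⨁ n, 𝒜 n) : (x - algebraMap K _ (ε x)) 0 = 0 := (eq_iff x _).1 rfl
  have map_mul (x y : ⨁ n, 𝒜 n) : ε (x * y) = ε x * ε y := by
    refine (eq_iff _ _).2 ?_
    have decompose : x * y - algebraMap K _ (ε x * ε y) = (x - algebraMap K _ (ε x)) * y +
        algebraMap K _ (ε x) * (y - algebraMap K _ (ε y)) := by
      rw [map_mul]
      noncomm_ring
    rw [decompose, DirectSum.add_apply,
      directSum_mul_apply_eq_zero (m := 1) (n := 0) (by simpa using spec x) (by simp) 0 one_pos,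
      directSum_mul_apply_eq_zero (m := 0) (n := 1) (by simp) (by simpa using spec y) 0 one_pos,
      add_zero]
  have map_add (x y : ⨁ n, 𝒜 n) : ε (x + y) = ε x + ε y := by
    refine (eq_iff _ _).2 ?_
    rw [map_add, add_sub_add_comm, DirectSum.add_apply, spec, spec, add_zero]
  have commutes (c : K) : ε (algebraMap K _ c) = c := (eq_iff _ _).2 (by rw [sub_self]; rfl)
  exact ⟨
    { toFun := ε
      map_one' := by simpa using commutes 1
      map_mul' := map_mul
      map_zero' := by simpa using commutes 0
      map_add' := map_add
      commutes' := commutes }, eq_iff⟩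

theorem isLocalRing (h : IsConnectedGraded K 𝒜) {d : ℕ}
    (vanish : ∀ n, d ≤ n → Subsingleton (𝒜 n)) : IsLocalRing (⨁ n, 𝒜 n) := by
  obtain ⟨ε, hε⟩ := h.exists_augmentation
  have : IsLocalHom (ε : (⨁ n, 𝒜 n) →+* K) := ⟨fun x hx => by
    have nilpotent : IsNilpotent (x - algebraMap K _ (ε x)) :=
      isNilpotent_of_apply_zero_eq_zero vanish ((hε x _).1 rfl)
    rw [← add_sub_cancel (algebraMap K _ (ε x)) x]
    exact nilpotent.isUnit_add_left_of_commute (hx.map (algebraMap K _))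
      (Algebra.commutes _ _).symm⟩
  exact RingHom.domain_isLocalRing (ε : (⨁ n, 𝒜 n) →+* K)

theorem nonempty_quotient_algEquiv (h : IsConnectedGraded K 𝒜) {d : ℕ}
    (vanish : ∀ n, d ≤ n → Subsingleton (𝒜 n)) :
    Nonempty ((TwoSidedIdeal.span {x : ⨁ n, 𝒜 n | IsNilpotent x ∧
      ∃ (n : ℕ) (a : 𝒜 n), x = of 𝒜 n a}).ringCon.Quotient ≃ₐ[K] K) := by
  classical
  obtain ⟨ε, hε⟩ := h.exists_augmentation
  set I := TwoSidedIdeal.span {x : ⨁ n, 𝒜 n | IsNilpotent x ∧ ∃ (n : ℕ) (a : 𝒜 n), x = of 𝒜 n a}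
  have mem_of_augmentation_eq_zero {x : ⨁ n, 𝒜 n} (hx : ε x = 0) : x ∈ I := by
    have apply_zero : x 0 = 0 := by simpa using (hε x 0).1 hx
    rw [← sum_support_of x]
    refine sum_mem fun n _ => TwoSidedIdeal.subset_span ⟨?_, n, x n, rfl⟩
    refine isNilpotent_of_apply_zero_eq_zero vanish ?_
    obtain rfl | hn := eq_or_ne n 0
    · rw [of_eq_same, apply_zero]
    · exact of_eq_of_ne _ _ _ hn.symm
  have I_eq_ker : I = TwoSidedIdeal.ker ε := by
    refine le_antisymm (TwoSidedIdeal.span_le.2 ?_) fun x hx =>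
      mem_of_augmentation_eq_zero ((TwoSidedIdeal.mem_ker ε).1 hx)
    rintro x ⟨nilpotent, -⟩
    exact (TwoSidedIdeal.mem_ker ε).2 (nilpotent.map ε).eq_zero
  have surjective : Function.Surjective ε := fun c => ⟨algebraMap K _ c, ε.commutes c⟩
  rw [I_eq_ker]
  exact ⟨AlgEquiv.ofRingEquiv
    (f := RingCon.quotientKerEquivOfSurjective (ε : (⨁ n, 𝒜 n) →+* K) surjective) ε.commutes⟩

end IsConnectedGraded

namespace QuantumCover

variable {N : ℕ} [NeZero N] {K A : Type u} [Field K] [Ring A] [Algebra K A] {ρ : K}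

theorem isConnectedGraded (S : QuantumCover N K A ρ) (hN : 3 ≤ N) :
    IsConnectedGraded K (HochschildCohomology K A) := by
  have : Nontrivial A := ⟨_, _, S.basis.ne_zero (0, 0)⟩
  refine ⟨smul_left_injective K unit_ne_zero, fun α => ?_⟩
  obtain ⟨c, rfl⟩ := S.exists_eq_smul_unit hN α
  exact ⟨c, rfl⟩

theorem hochschild_subsingleton_of_three_le (S : QuantumCover N K A ρ)
    (hρ : Function.Injective fun n : ℕ => ρ ^ n) :
    ∀ n, 3 ≤ n → Subsingleton (HochschildCohomology K A n)
  | n + 3, _ => S.hochschild_subsingleton hρ n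

theorem finrank_hochschildRing (S : QuantumCover N K A ρ) (hN : 3 ≤ N)
    (hρ : Function.Injective fun n : ℕ => ρ ^ n) :
    Module.finrank K (HochschildRing K A) = 4 := by
  let e₀ : K ≃ₗ[K] HochschildCohomology K A 0 :=
    LinearEquiv.ofBijective (LinearMap.toSpanSingleton K _ (HochschildCohomology.unit K A))
      (S.isConnectedGraded hN)
  obtain ⟨e₁⟩ := S.nonempty_hochschild_one_linearEquiv hρ
  obtain ⟨e₂⟩ := S.nonempty_hochschild_two_linearEquiv hρ
  have finite : ∀ n, Module.Finite K (HochschildCohomology K A n)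
    | 0 => Module.Finite.equiv e₀
    | 1 => Module.Finite.equiv e₁.symm
    | 2 => Module.Finite.equiv e₂.symm
    | n + 3 => have := S.hochschild_subsingleton hρ n; inferInstance
  rw [finrank_directSum_eq_sum_range (S.hochschild_subsingleton_of_three_le hρ)]
  simp [Finset.sum_range_succ, ← e₀.finrank_eq, e₁.finrank_eq, e₂.finrank_eq]

end QuantumCover

/-! ### Matrix representations of path algebras -/

namespace PathAlgebra

noncomputable section

variable {K V : Type*} [Quiver V] [Field K]

theorem vertex_mul_ofPath {a b : V} (p : Quiver.Path a b) :
    vertex K a * ofPath K ⟨a, b, p⟩ = ofPath K ⟨a, b, p⟩ := by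
  rw [vertex, ofPath_mul_ofPath, mulPath_of_eq, Quiver.Path.nil_comp]

theorem vertex_mul_ofPath_of_ne {v a b : V} (h : v ≠ a) (p : Quiver.Path a b) :
    vertex K v * ofPath K ⟨a, b, p⟩ = 0 := by
  rw [vertex, ofPath_mul_ofPath, mulPath_of_ne h]

theorem ofPath_mul_vertex {a b : V} (p : Quiver.Path a b) :
    ofPath K ⟨a, b, p⟩ * vertex K b = ofPath K ⟨a, b, p⟩ := by
  rw [vertex, ofPath_mul_ofPath, mulPath_of_eq, Quiver.Path.comp_nil]

theorem ofPath_mul_vertex_of_ne {v a b : V} (h : b ≠ v) (p : Quiver.Path a b) :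
    ofPath K ⟨a, b, p⟩ * vertex K v = 0 := by
  rw [vertex, ofPath_mul_ofPath, mulPath_of_ne h]

theorem ofPath_cons {a b c : V} (p : Quiver.Path a b) (f : b ⟶ c) :
    ofPath K ⟨a, c, p.cons f⟩ = ofPath K ⟨a, b, p⟩ * arrow K f := by
  rw [arrow, ofPath_mul_ofPath, mulPath_of_eq, Quiver.Hom.toPath, Quiver.Path.comp_cons,
    Quiver.Path.comp_nil]

variable [Fintype V] [DecidableEq V] {R : Type*} [Ring R] [Algebra K R]
  (w : ∀ {a b : V}, (a ⟶ b) → R)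

/-- The representation of the path algebra by matrices indexed by the vertices, in which an arrow
`f : a ⟶ b` acts as the matrix with the single entry `w f`, at the position `(a, b)`. -/
def toMatrix : PathAlgebra K V →ₐ[K] Matrix V V R :=
  AlgHom.ofLinearMap (extend fun p => Matrix.single p.1 p.2.1 (p.2.2.weight w))
    (by
      rw [one_def, map_sum, ← Matrix.sum_single_one]
      simp only [vertex, extend_ofPath, Quiver.Path.weight_nil])
    (by
      intro x y
      refine induction x (by simp) (fun x₁ x₂ h₁ h₂ => by simp only [add_mul, map_add, h₁, h₂])
        fun c p => ?_
      refine induction y (by simp) (fun y₁ y₂ h₁ h₂ => by simp only [mul_add, map_add, h₁, h₂])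
        fun d r => ?_
      rw [smul_mul_smul_comm, map_smul, map_smul, map_smul, smul_mul_smul_comm]
      congr 1
      obtain ⟨a, b, p⟩ := p
      obtain ⟨a', b', r⟩ := r
      rw [ofPath_mul_ofPath, extend_ofPath, extend_ofPath]
      by_cases h : b = a'
      · subst h
        rw [mulPath_of_eq, extend_ofPath, Quiver.Path.weight_comp, Matrix.single_mul_single_same]
      · rw [mulPath_of_ne h, map_zero, Matrix.single_mul_single_of_ne _ _ _ _ h])

theorem toMatrix_ofPath {a b : V} (p : Quiver.Path a b) :
    toMatrix w (ofPath K ⟨a, b, p⟩) = Matrix.single a b (p.weight w) :=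
  extend_ofPath _ _

theorem toMatrix_vertex (v : V) : toMatrix w (vertex K v) = Matrix.single v v 1 := by
  rw [vertex, toMatrix_ofPath, Quiver.Path.weight_nil]

theorem toMatrix_arrow {a b : V} (f : a ⟶ b) :
    toMatrix w (arrow K f) = Matrix.single a b (w f) := by
  rw [arrow, toMatrix_ofPath, Quiver.Hom.toPath, Quiver.Path.weight_cons, Quiver.Path.weight_nil,
    one_mul]

end

end PathAlgebra

/-! ### The monomial basis of `A₀(q₀, q₁, q₂, q₃)` -/

theorem GammaVertex.mod2_add_one (m : GammaVertex) : (m + 1).mod2 = m.mod2 + 1 := by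
  revert m; decide

namespace GammaAlgebra

noncomputable section

open PathAlgebra

section PathAlgebra

variable (K : Type u) [Field K]

/-- The arrow `a_{l,m}` with `l = m + k`. In terms of the index `k` relative to the source, the
relations of `A₀(q₀, q₁, q₂, q₃)` have the same form at every vertex. -/
def twistedArrow (k : ZMod 2) (m : GammaVertex) : PathAlgebra K GammaVertex :=
  arrow K (V := GammaVertex) (w := m + 1) (GammaArrow.a (m.mod2 + k) m)

variable {K}

theorem arrow_a (l : ZMod 2) (m : GammaVertex) :
    arrow K (V := GammaVertex) (w := m + 1) (GammaArrow.a l m) =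
      twistedArrow K (l - m.mod2) m := by
  rw [twistedArrow, add_sub_cancel]

theorem gammaE_mul_gammaE (i j : GammaVertex) :
    gammaE K i * gammaE K j = if i = j then gammaE K i else 0 := by
  split_ifs with h
  · subst h
    exact vertex_mul_ofPath _
  · exact vertex_mul_ofPath_of_ne h _

theorem gammaE_mul_twistedArrow (i : GammaVertex) (k : ZMod 2) (m : GammaVertex) :
    gammaE K i * twistedArrow K k m = if m = i then twistedArrow K k m else 0 := by
  split_ifs with h
  · subst h
    exact vertex_mul_ofPath _
  · exact vertex_mul_ofPath_of_ne (Ne.symm h) _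

theorem twistedArrow_mul_gammaE (i : GammaVertex) (k : ZMod 2) (m : GammaVertex) :
    twistedArrow K k m * gammaE K i = if m + 1 = i then twistedArrow K k m else 0 := by
  split_ifs with h
  · subst h
    exact ofPath_mul_vertex _
  · exact ofPath_mul_vertex_of_ne h _

theorem twistedArrow_mul_gammaE_mul (k : ZMod 2) (i : GammaVertex)
    (x : PathAlgebra K GammaVertex) :
    twistedArrow K k i * (gammaE K (i + 1) * x) = twistedArrow K k i * x := by
  rw [← mul_assoc, twistedArrow_mul_gammaE, if_pos rfl]

theorem gammaE_mul_gammaX (i : GammaVertex) (l : ZMod 2) :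
    gammaE K i * gammaX K l = twistedArrow K (l - i.mod2) i := by
  simp [gammaX, arrow_a, Finset.mul_sum, gammaE_mul_twistedArrow]

theorem gammaE_mul_gammaX_mul_gammaX (i : GammaVertex) (l l' : ZMod 2) :
    gammaE K i * (gammaX K l * gammaX K l') =
      twistedArrow K (l - i.mod2) i * twistedArrow K (l' - (i + 1).mod2) (i + 1) := by
  rw [← mul_assoc, gammaE_mul_gammaX, ← twistedArrow_mul_gammaE_mul, gammaE_mul_gammaX]

theorem gammaE_mul_gammaX_mul_gammaX_add_one (i : GammaVertex) (l : ZMod 2) :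
    gammaE K i * (gammaX K l * gammaX K (l + 1)) =
      twistedArrow K (l - i.mod2) i * twistedArrow K (l - i.mod2) (i + 1) := by
  rw [gammaE_mul_gammaX_mul_gammaX, GammaVertex.mod2_add_one, add_sub_add_right_eq_sub]

theorem gammaE_mul_smul_gammaX_sq_add (i : GammaVertex) (a : K) :
    gammaE K i * (a • gammaX K i.mod2 ^ 2 + gammaX K (i.mod2 + 1) ^ 2) =
      a • (twistedArrow K 0 i * twistedArrow K 1 (i + 1)) +
        twistedArrow K 1 i * twistedArrow K 0 (i + 1) := by
  have sub_add_one (l : ZMod 2) : l - (l + 1) = 1 := by revert l; decide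
  rw [pow_two, pow_two, mul_add, mul_smul_comm, gammaE_mul_gammaX_mul_gammaX,
    gammaE_mul_gammaX_mul_gammaX, GammaVertex.mod2_add_one, sub_self, sub_self, sub_add_one,
    add_sub_cancel_left]

theorem eq_sum_gammaE_mul (x : PathAlgebra K GammaVertex) : x = ∑ i, gammaE K i * x := by
  rw [← Finset.sum_mul, ← one_def, one_mul]

/-- The linear combination of the arrows `a_{m+k,m}` with the coefficients `c m`. -/
def arrowSum (c : GammaVertex → K) (k : ZMod 2) : PathAlgebra K GammaVertex :=
  ∑ m, c m • twistedArrow K k m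

theorem gammaE_mul_arrowSum (i : GammaVertex) (c : GammaVertex → K) (k : ZMod 2) :
    gammaE K i * arrowSum c k = c i • twistedArrow K k i := by
  simp [arrowSum, Finset.mul_sum, gammaE_mul_twistedArrow]

theorem gammaE_mul_arrowSum_comm (i : GammaVertex) (c : GammaVertex → K) (k : ZMod 2) :
    gammaE K i * arrowSum c k = arrowSum c k * gammaE K (i + 1) := by
  rw [gammaE_mul_arrowSum]
  simp [arrowSum, Finset.sum_mul, twistedArrow_mul_gammaE]

theorem gammaE_mul_arrowSum_mul_arrowSum (i : GammaVertex) (c d : GammaVertex → K)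
    (k l : ZMod 2) :
    gammaE K i * (arrowSum c k * arrowSum d l) =
      (c i * d (i + 1)) • (twistedArrow K k i * twistedArrow K l (i + 1)) := by
  rw [← mul_assoc, gammaE_mul_arrowSum, smul_mul_assoc, ← twistedArrow_mul_gammaE_mul,
    gammaE_mul_arrowSum, mul_smul_comm, smul_smul]

/-- The monomials `1`, `u`, `v` and `uv` in `u = ∑ₘ c m • a_{m,m}` and `v = ∑ₘ a_{m+1,m}`. -/
def word (c : GammaVertex → K) : Fin 4 → PathAlgebra K GammaVertex :=
  ![1, arrowSum c 0, arrowSum 1 1, arrowSum c 0 * arrowSum 1 1]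

/-- The part of `word c m` starting at the vertex `i`, for `p = (i, m)`. -/
def monomial (c : GammaVertex → K) (p : GammaVertex × Fin 4) : PathAlgebra K GammaVertex :=
  gammaE K p.1 * word c p.2

end PathAlgebra

section Relations

variable {K : Type u} [Field K] {B : Type*} [Ring B] [Algebra K B]
  {f : PathAlgebra K GammaVertex →ₐ[K] B} {q c : GammaVertex → K} {ρ : K}

theorem map_eq_of_gammaE_mul {x y : PathAlgebra K GammaVertex}
    (h : ∀ i, f (gammaE K i * x) = f (gammaE K i * y)) : f x = f y := by
  rw [eq_sum_gammaE_mul x, eq_sum_gammaE_mul y, map_sum, map_sum]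
  exact Finset.sum_congr rfl fun i _ => h i

theorem forall_gammaRelations_map_eq_zero_iff :
    (∀ r ∈ gammaRelations 0 q, f r = 0) ↔
      (∀ k i, f (twistedArrow K k i * twistedArrow K k (i + 1)) = 0) ∧
        ∀ i, q i • f (twistedArrow K 0 i * twistedArrow K 1 (i + 1)) +
          f (twistedArrow K 1 i * twistedArrow K 0 (i + 1)) = 0 := by
  refine ⟨fun h => ⟨fun k i => ?_, fun i => ?_⟩, fun ⟨h_same, h_mixed⟩ r hr => ?_⟩
  · have := h _ (Or.inl ⟨k + i.mod2, rfl⟩)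
    rw [← add_sub_cancel_right k i.mod2, ← gammaE_mul_gammaX_mul_gammaX_add_one, map_mul, this,
      mul_zero]
  · have := h _ (Or.inr ⟨i, rfl⟩)
    rwa [mul_zero, zero_add, gammaE_mul_smul_gammaX_sq_add, map_add, map_smul] at this
  · obtain ⟨l, rfl⟩ | ⟨i, rfl⟩ := hr
    · rw [← map_zero f]
      refine map_eq_of_gammaE_mul fun i => ?_
      rw [gammaE_mul_gammaX_mul_gammaX_add_one, h_same, mul_zero, map_zero]
    · rw [mul_zero, zero_add, gammaE_mul_smul_gammaX_sq_add, map_add, map_smul, h_mixed]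

theorem map_gammaE_mul_gammaE (i j : GammaVertex) :
    f (gammaE K i) * f (gammaE K j) = if i = j then f (gammaE K i) else 0 := by
  rw [← map_mul, gammaE_mul_gammaE, apply_ite f, map_zero]

theorem sum_map_gammaE : ∑ i, f (gammaE K i) = 1 := by
  rw [← map_sum, ← map_one f, one_def]

theorem map_gammaE_mul_arrowSum_comm (i : GammaVertex) (c : GammaVertex → K) (k : ZMod 2) :
    f (gammaE K i) * f (arrowSum c k) = f (arrowSum c k) * f (gammaE K (i + 1)) := by
  rw [← map_mul, gammaE_mul_arrowSum_comm, map_mul]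

theorem map_monomial (i : GammaVertex) (m : Fin 4) :
    f (monomial c (i, m)) = f (gammaE K i) * (![1, f (arrowSum c 0), f (arrowSum 1 1),
      f (arrowSum c 0) * f (arrowSum 1 1)] : Fin 4 → B) m := by
  fin_cases m <;> simp [monomial, word]

theorem map_arrowSum_mul_self (hf : ∀ r ∈ gammaRelations 0 q, f r = 0) (c : GammaVertex → K)
    (k : ZMod 2) : f (arrowSum c k) * f (arrowSum c k) = 0 := by
  rw [← map_mul, ← map_zero f]
  refine map_eq_of_gammaE_mul fun i => ?_
  rw [gammaE_mul_arrowSum_mul_arrowSum, map_smul,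
    (forall_gammaRelations_map_eq_zero_iff.1 hf).1, smul_zero, mul_zero, map_zero]

theorem map_arrowSum_one_mul_arrowSum_zero (hf : ∀ r ∈ gammaRelations 0 q, f r = 0)
    (hc : ∀ i, c (i + 1) * q i = ρ * c i) :
    f (arrowSum 1 1) * f (arrowSum c 0) = -(ρ • (f (arrowSum c 0) * f (arrowSum 1 1))) := by
  rw [← map_mul, ← map_mul, ← map_smul, ← map_neg]
  refine map_eq_of_gammaE_mul fun i => ?_
  have relation := (forall_gammaRelations_map_eq_zero_iff.1 hf).2 i
  rw [mul_neg, mul_smul_comm, gammaE_mul_arrowSum_mul_arrowSum, gammaE_mul_arrowSum_mul_arrowSum,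
    map_smul, map_neg, map_smul, map_smul, eq_neg_of_add_eq_zero_right relation, smul_neg,
    smul_smul, smul_smul, Pi.one_apply, Pi.one_apply, one_mul, mul_one, hc]

end Relations

section Spanning

variable {K : Type u} [Field K] {B : Type*} [Ring B] [Algebra K B]
  {f : PathAlgebra K GammaVertex →ₐ[K] B} {q c : GammaVertex → K} {ρ : K}

variable (f c) in
/-- The span of the images of the monomials under a homomorphism from the path algebra. -/
def monomialSpan : Submodule K B := Submodule.span K (Set.range fun p => f (monomial c p))

theorem map_monomial_mem (p : GammaVertex × Fin 4) : f (monomial c p) ∈ monomialSpan f c :=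
  Submodule.subset_span ⟨p, rfl⟩

theorem mul_mem_monomialSpan {a x : B} (h : ∀ p, a * f (monomial c p) ∈ monomialSpan f c)
    (hx : x ∈ monomialSpan f c) : a * x ∈ monomialSpan f c :=
  (Submodule.span_le (p := (monomialSpan f c).comap (LinearMap.mulLeft K a))).2
    (Set.range_subset_iff.2 h) hx

theorem map_gammaE_mul_mem (i : GammaVertex) {x : B} (hx : x ∈ monomialSpan f c) :
    f (gammaE K i) * x ∈ monomialSpan f c := by
  refine mul_mem_monomialSpan (fun p => ?_) hx
  rw [← map_mul, monomial, ← mul_assoc, gammaE_mul_gammaE]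
  split_ifs with h
  · subst h
    exact map_monomial_mem p
  · rw [zero_mul, map_zero]
    exact Submodule.zero_mem _

theorem map_word_mem (m : Fin 4) : f (word c m) ∈ monomialSpan f c := by
  rw [eq_sum_gammaE_mul (word c m), map_sum]
  exact Submodule.sum_mem _ fun i _ => map_monomial_mem (i, m)

theorem map_arrowSum_mul_mem {d : GammaVertex → K} {k : ZMod 2}
    (h : ∀ m, f (arrowSum d k) * f (word c m) ∈ monomialSpan f c)
    {x : B} (hx : x ∈ monomialSpan f c) : f (arrowSum d k) * x ∈ monomialSpan f c := by
  refine mul_mem_monomialSpan (fun ⟨i, m⟩ => ?_) hx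
  have move_left : arrowSum d k * monomial c (i, m) =
      gammaE K (i - 1) * (arrowSum d k * word c m) := by
    rw [monomial, ← mul_assoc, ← mul_assoc, gammaE_mul_arrowSum_comm, sub_add_cancel]
  rw [← map_mul, move_left, map_mul, map_mul]
  exact map_gammaE_mul_mem _ (h m)

theorem map_arrowSum_zero_mul_word_mem (hf : ∀ r ∈ gammaRelations 0 q, f r = 0) (m : Fin 4) :
    f (arrowSum c 0) * f (word c m) ∈ monomialSpan f c := by
  fin_cases m
  · simpa [word] using map_word_mem (f := f) (c := c) 1
  · simp [word, map_arrowSum_mul_self hf]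
  · simpa [word] using map_word_mem (f := f) (c := c) 3
  · simp [word, ← mul_assoc, map_arrowSum_mul_self hf]

theorem map_arrowSum_one_mul_word_mem (hf : ∀ r ∈ gammaRelations 0 q, f r = 0)
    (hc : ∀ i, c (i + 1) * q i = ρ * c i) (m : Fin 4) :
    f (arrowSum 1 1) * f (word c m) ∈ monomialSpan f c := by
  have v_mul_u := map_arrowSum_one_mul_arrowSum_zero hf hc
  fin_cases m
  · simpa [word] using map_word_mem (f := f) (c := c) 2
  · simpa [word, v_mul_u] using (monomialSpan f c).smul_mem ρ (map_word_mem 3)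
  · simp [word, map_arrowSum_mul_self hf]
  · have v_mul_u_mul_v : f (arrowSum 1 1) * (f (arrowSum c 0) * f (arrowSum 1 1)) = 0 := by
      rw [← mul_assoc, v_mul_u, neg_mul, smul_mul_assoc, mul_assoc, map_arrowSum_mul_self hf,
        mul_zero, smul_zero, neg_zero]
    simp [word, v_mul_u_mul_v]

theorem map_twistedArrow_mul_mem (hf : ∀ r ∈ gammaRelations 0 q, f r = 0) (hc₀ : ∀ i, c i ≠ 0)
    (hc : ∀ i, c (i + 1) * q i = ρ * c i) (k : ZMod 2) (m : GammaVertex) {x : B}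
    (hx : x ∈ monomialSpan f c) : f (twistedArrow K k m) * x ∈ monomialSpan f c := by
  have of_arrowSum {d : GammaVertex → K} (hd : d m ≠ 0)
      (h : f (arrowSum d k) * x ∈ monomialSpan f c) :
      f (twistedArrow K k m) * x ∈ monomialSpan f c := by
    rw [← inv_smul_smul₀ hd (twistedArrow K k m), ← gammaE_mul_arrowSum, map_smul, map_mul,
      smul_mul_assoc, mul_assoc]
    exact Submodule.smul_mem _ _ (map_gammaE_mul_mem _ h)
  obtain rfl | rfl : k = 0 ∨ k = 1 := by clear of_arrowSum; revert k; decide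
  · exact of_arrowSum (hc₀ m) (map_arrowSum_mul_mem (map_arrowSum_zero_mul_word_mem hf) hx)
  · exact of_arrowSum one_ne_zero
      (map_arrowSum_mul_mem (map_arrowSum_one_mul_word_mem hf hc) hx)

theorem map_ofPath_mul_mem (hf : ∀ r ∈ gammaRelations 0 q, f r = 0) (hc₀ : ∀ i, c i ≠ 0)
    (hc : ∀ i, c (i + 1) * q i = ρ * c i) {a b : GammaVertex} (p : Quiver.Path a b) {x : B}
    (hx : x ∈ monomialSpan f c) : f (ofPath K ⟨a, b, p⟩) * x ∈ monomialSpan f c := by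
  induction p generalizing x with
  | nil => exact map_gammaE_mul_mem a hx
  | @cons m _ p g ih =>
    rcases g with ⟨l⟩
    rw [ofPath_cons, map_mul, mul_assoc]
    refine ih ?_
    change f (arrow K (V := GammaVertex) (w := m + 1) (GammaArrow.a l m)) * x ∈ _
    rw [arrow_a]
    exact map_twistedArrow_mul_mem hf hc₀ hc _ _ hx

theorem monomialSpan_eq_top (hf_surj : Function.Surjective f)
    (hf : ∀ r ∈ gammaRelations 0 q, f r = 0) (hc₀ : ∀ i, c i ≠ 0)
    (hc : ∀ i, c (i + 1) * q i = ρ * c i) : monomialSpan f c = ⊤ := by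
  refine eq_top_iff.2 fun x _ => ?_
  obtain ⟨x, rfl⟩ := hf_surj x
  refine PathAlgebra.induction x (by simp) (fun x y hx hy => ?_) fun a p => ?_
  · rw [map_add]
    exact Submodule.add_mem _ hx hy
  · rw [map_smul, ← mul_one (f _), ← map_one f]
    exact Submodule.smul_mem _ _ (map_ofPath_mul_mem hf hc₀ hc p.2.2 (map_word_mem 0))

end Spanning

section Representation

variable {K : Type u} [Field K]

/-- The matrix of right multiplication by `u` on `K⟨u, v⟩ / (u², v², vu + ρ uv)`, acting on row
vectors of coordinates in the basis `1`, `u`, `v`, `uv`. -/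
def planeU (ρ : K) : Matrix (Fin 4) (Fin 4) K :=
  !![0, 1, 0, 0; 0, 0, 0, 0; 0, 0, 0, -ρ; 0, 0, 0, 0]

/-- The matrix of right multiplication by `v` on `K⟨u, v⟩ / (u², v², vu + ρ uv)`, acting on row
vectors of coordinates in the basis `1`, `u`, `v`, `uv`. -/
def planeV (K : Type u) [Field K] : Matrix (Fin 4) (Fin 4) K :=
  !![0, 0, 1, 0; 0, 0, 0, 1; 0, 0, 0, 0; 0, 0, 0, 0]

theorem planeU_mul_planeU (ρ : K) : planeU ρ * planeU ρ = 0 := by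
  ext i j
  fin_cases i <;> fin_cases j <;> simp [planeU, Matrix.mul_apply, Fin.sum_univ_four]

theorem planeV_mul_planeV : planeV K * planeV K = 0 := by
  ext i j
  fin_cases i <;> fin_cases j <;> simp [planeV, Matrix.mul_apply, Fin.sum_univ_four]

theorem planeV_mul_planeU (ρ : K) : planeV K * planeU ρ = -(ρ • (planeU ρ * planeV K)) := by
  ext i j
  fin_cases i <;> fin_cases j <;> simp [planeU, planeV, Matrix.mul_apply, Fin.sum_univ_four]

/-- The monomials `1`, `u`, `v` and `uv` in the matrices `planeU ρ` and `planeV K`. -/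
def planeWord (ρ : K) : Fin 4 → Matrix (Fin 4) (Fin 4) K :=
  ![1, planeU ρ, planeV K, planeU ρ * planeV K]

theorem planeWord_zero_apply (ρ : K) (m n : Fin 4) :
    planeWord ρ m 0 n = if m = n then 1 else 0 := by
  fin_cases m <;> fin_cases n <;> simp [planeWord, planeU, planeV]

/-- The matrix by which the arrow `a_{m+k,m}` acts. -/
def arrowWeight (c : GammaVertex → K) (ρ : K) (k : ZMod 2) (m : GammaVertex) :
    Matrix (Fin 4) (Fin 4) K :=
  if k = 0 then (c m)⁻¹ • planeU ρ else planeV K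

theorem arrowWeight_zero (c : GammaVertex → K) (ρ : K) (m : GammaVertex) :
    arrowWeight c ρ 0 m = (c m)⁻¹ • planeU ρ := if_pos rfl

theorem arrowWeight_one (c : GammaVertex → K) (ρ : K) (m : GammaVertex) :
    arrowWeight c ρ 1 m = planeV K := if_neg one_ne_zero

theorem arrowWeight_mul_arrowWeight (c : GammaVertex → K) (ρ : K) (k : ZMod 2)
    (m n : GammaVertex) : arrowWeight c ρ k m * arrowWeight c ρ k n = 0 := by
  unfold arrowWeight
  split_ifs
  · rw [smul_mul_smul_comm, planeU_mul_planeU, smul_zero]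
  · exact planeV_mul_planeV

/-- The representation of the path algebra on row vectors with one component in
`K⟨u, v⟩ / (u², v², vu + ρ uv)` for each vertex. -/
def planeRep (c : GammaVertex → K) (ρ : K) :
    PathAlgebra K GammaVertex →ₐ[K] Matrix GammaVertex GammaVertex (Matrix (Fin 4) (Fin 4) K) :=
  toMatrix fun {_ _} f => GammaArrow.casesOn f fun l m => arrowWeight c ρ (l - m.mod2) m

theorem planeRep_gammaE (c : GammaVertex → K) (ρ : K) (i : GammaVertex) :
    planeRep c ρ (gammaE K i) = Matrix.single i i 1 :=
  toMatrix_vertex _ i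

theorem planeRep_twistedArrow (c : GammaVertex → K) (ρ : K) (k : ZMod 2) (m : GammaVertex) :
    planeRep c ρ (twistedArrow K k m) = Matrix.single m (m + 1) (arrowWeight c ρ k m) := by
  refine (toMatrix_arrow _ _).trans ?_
  change Matrix.single m (m + 1) (arrowWeight c ρ (m.mod2 + k - m.mod2) m) = _
  rw [add_sub_cancel_left]

theorem planeRep_twistedArrow_mul_twistedArrow (c : GammaVertex → K) (ρ : K) (k l : ZMod 2)
    (i : GammaVertex) :
    planeRep c ρ (twistedArrow K k i * twistedArrow K l (i + 1)) =
      Matrix.single i (i + 1 + 1) (arrowWeight c ρ k i * arrowWeight c ρ l (i + 1)) := by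
  rw [map_mul, planeRep_twistedArrow, planeRep_twistedArrow, Matrix.single_mul_single_same]

theorem planeRep_eq_zero_of_mem {q c : GammaVertex → K} {ρ : K} (hc₀ : ∀ i, c i ≠ 0)
    (hc : ∀ i, c (i + 1) * q i = ρ * c i) : ∀ r ∈ gammaRelations 0 q, planeRep c ρ r = 0 := by
  refine forall_gammaRelations_map_eq_zero_iff.2 ⟨fun k i => ?_, fun i => ?_⟩
  · rw [planeRep_twistedArrow_mul_twistedArrow, arrowWeight_mul_arrowWeight, Matrix.single_zero]
  · have coefficient : q i * (c i)⁻¹ = (c (i + 1))⁻¹ * ρ := by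
      have h₁ := hc₀ i
      have h₂ := hc₀ (i + 1)
      field_simp
      linear_combination hc i
    rw [planeRep_twistedArrow_mul_twistedArrow, planeRep_twistedArrow_mul_twistedArrow,
      arrowWeight_zero, arrowWeight_zero, arrowWeight_one, arrowWeight_one, mul_smul_comm,
      planeV_mul_planeU, smul_mul_assoc, Matrix.smul_single, ← Matrix.single_add, smul_neg,
      smul_smul, smul_smul, coefficient, add_neg_cancel, Matrix.single_zero]

theorem exists_planeRep_monomial_eq_single {c : GammaVertex → K} (ρ : K) (hc₀ : ∀ i, c i ≠ 0)
    (p : GammaVertex × Fin 4) :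
    ∃ j, planeRep c ρ (monomial c p) = Matrix.single p.1 j (planeWord ρ p.2) := by
  obtain ⟨i, m⟩ := p
  fin_cases m
  · exact ⟨i, by simp [monomial, word, planeWord, planeRep_gammaE]⟩
  · refine ⟨i + 1, ?_⟩
    simp [monomial, word, planeWord, gammaE_mul_arrowSum, planeRep_twistedArrow,
      arrowWeight_zero, hc₀, -map_mul]
  · refine ⟨i + 1, ?_⟩
    simp [monomial, word, planeWord, gammaE_mul_arrowSum, planeRep_twistedArrow,
      arrowWeight_one, -map_mul]
  · refine ⟨i + 1 + 1, ?_⟩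
    simp [monomial, word, planeWord, gammaE_mul_arrowSum_mul_arrowSum,
      planeRep_twistedArrow_mul_twistedArrow, arrowWeight_zero, arrowWeight_one, hc₀, -map_mul]

end Representation

section Basis

variable {K : Type u} [Field K] {q c : GammaVertex → K} {ρ : K}

variable (q) in
/-- The projection of the path algebra onto `A₀(q₀, q₁, q₂, q₃)`. -/
def proj : PathAlgebra K GammaVertex →ₐ[K] GammaAlgebra 0 q :=
  (TwoSidedIdeal.span (gammaRelations 0 q)).ringCon.mkₐ K

theorem proj_surjective : Function.Surjective (proj q) :=
  RingCon.mkₐ_surjective (α := K) (TwoSidedIdeal.span (gammaRelations 0 q)).ringCon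

theorem proj_eq_zero_of_mem : ∀ r ∈ gammaRelations 0 q, proj q r = 0 :=
  fun _ h => (RingCon.eq _).2 (TwoSidedIdeal.subset_span h)

/-- The representation of `A₀(q₀, q₁, q₂, q₃)` induced by `planeRep`. -/
def quotientRep (hc₀ : ∀ i, c i ≠ 0) (hc : ∀ i, c (i + 1) * q i = ρ * c i) :
    GammaAlgebra 0 q →ₐ[K] Matrix GammaVertex GammaVertex (Matrix (Fin 4) (Fin 4) K) :=
  RingCon.liftₐ _ (planeRep c ρ) <| TwoSidedIdeal.ringCon_le_iff.1 <|
    (TwoSidedIdeal.span_le (I := TwoSidedIdeal.ker (planeRep c ρ))).2 fun r hr =>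
      (TwoSidedIdeal.mem_ker _).2 (planeRep_eq_zero_of_mem hc₀ hc r hr)

theorem quotientRep_proj (hc₀ : ∀ i, c i ≠ 0) (hc : ∀ i, c (i + 1) * q i = ρ * c i)
    (x : PathAlgebra K GammaVertex) : quotientRep hc₀ hc (proj q x) = planeRep c ρ x :=
  rfl

theorem linearIndependent_monomial (hc₀ : ∀ i, c i ≠ 0)
    (hc : ∀ i, c (i + 1) * q i = ρ * c i) :
    LinearIndependent K fun p => proj q (monomial c p) := by
  let dual (r : GammaVertex × Fin 4) : GammaAlgebra 0 q →ₗ[K] K :=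
    (∑ j, Matrix.entryLinearMap K K 0 r.2 ∘ₗ
      Matrix.entryLinearMap K (Matrix (Fin 4) (Fin 4) K) r.1 j) ∘ₗ (quotientRep hc₀ hc).toLinearMap
  have dual_monomial (r p) : dual r (proj q (monomial c p)) = if p = r then 1 else 0 := by
    obtain ⟨j, hj⟩ := exists_planeRep_monomial_eq_single ρ hc₀ p
    calc
      dual r (proj q (monomial c p))
        = ∑ j', Matrix.single p.1 j (planeWord ρ p.2) r.1 j' 0 r.2 := by
          simp [dual, quotientRep_proj, hj]
      _ = if p.1 = r.1 then planeWord ρ p.2 0 r.2 else 0 := by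
          split_ifs with h
          · rw [Finset.sum_eq_single j (fun j' _ hj' => by simp [hj'.symm]) (by simp), h,
              Matrix.single_apply_same]
          · simp [h]
      _ = if p = r then 1 else 0 := by
          simp [planeWord_zero_apply, Prod.ext_iff, ite_and]
  refine LinearIndependent.of_pairwise_dual_eq_zero_one _ dual (fun r p hrp => ?_) fun r => ?_
  · exact (dual_monomial r p).trans (if_neg hrp.symm)
  · exact (dual_monomial r r).trans (if_pos rfl)

/-- The algebra `A₀(q₀, q₁, q₂, q₃)` as a cover of the quantum exterior algebra: rescaling the
arrows by `c` replaces the four parameters `q i` by the single parameter `ρ`. -/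
def quantumCover (hc₀ : ∀ i, c i ≠ 0) (hc : ∀ i, c (i + 1) * q i = ρ * c i) :
    QuantumCover 4 K (GammaAlgebra 0 q) ρ where
  e i := proj q (gammaE K i)
  u := proj q (arrowSum c 0)
  v := proj q (arrowSum 1 1)
  basis := Module.Basis.mk (linearIndependent_monomial hc₀ hc)
    (monomialSpan_eq_top proj_surjective proj_eq_zero_of_mem hc₀ hc).ge
  e_mul_e i j := map_gammaE_mul_gammaE (f := proj q) i j
  sum_e := sum_map_gammaE (f := proj q)
  e_mul_u i := map_gammaE_mul_arrowSum_comm (f := proj q) i c 0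
  e_mul_v i := map_gammaE_mul_arrowSum_comm (f := proj q) i 1 1
  u_mul_u := map_arrowSum_mul_self proj_eq_zero_of_mem c 0
  v_mul_v := map_arrowSum_mul_self proj_eq_zero_of_mem 1 1
  v_mul_u := map_arrowSum_one_mul_arrowSum_zero proj_eq_zero_of_mem hc
  basis_apply i m := (Module.Basis.mk_apply _ _ _).trans (map_monomial (f := proj q) i m)

theorem exists_rescaling (hq : ∀ i, q i ≠ 0) (hρ : ρ ^ 4 = q 0 * q 1 * q 2 * q 3) :
    ∃ c : GammaVertex → K, (∀ i, c i ≠ 0) ∧ ∀ i, c (i + 1) * q i = ρ * c i := by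
  have h₀ := hq 0
  have h₁ := hq 1
  have h₂ := hq 2
  have h₃ := hq 3
  have hρ₀ : ρ ≠ 0 := by
    rintro rfl
    simp [h₀, h₁, h₂, h₃] at hρ
  refine ⟨(![1, ρ / q 0, ρ ^ 2 / (q 0 * q 1), ρ ^ 3 / (q 0 * q 1 * q 2)] : Fin 4 → K),
    fun i => ?_, fun i => ?_⟩
  · change Fin 4 at i
    fin_cases i <;> simp [h₀, h₁, h₂, hρ₀]
  · change Fin 4 at i
    fin_cases i
    · change ρ / q 0 * q 0 = ρ * 1
      field_simp
    · change ρ ^ 2 / (q 0 * q 1) * q 1 = ρ * (ρ / q 0)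
      field_simp
    · change ρ ^ 3 / (q 0 * q 1 * q 2) * q 2 = ρ * (ρ ^ 2 / (q 0 * q 1))
      field_simp
    · change 1 * q 3 = ρ * (ρ ^ 3 / (q 0 * q 1 * q 2))
      field_simp
      linear_combination -hρ

end Basis

end

end GammaAlgebra

theorem injective_pow_of_not_isOfFinOrder₀ {G : Type*} [GroupWithZero G] {x : G} (hx : x ≠ 0)
    (h : ¬IsOfFinOrder x) : Function.Injective fun n : ℕ => x ^ n := by
  lift x to Gˣ using hx.isUnit
  rw [Units.isOfFinOrder_val] at h
  exact fun m n hmn => injective_pow_iff_not_isOfFinOrder.2 h (Units.ext (by simpa using hmn))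

theorem corollary3p6 {K : Type u} [Field K] [IsAlgClosed K] (q : GammaVertex → K)
    (hq : ∀ i, q i ≠ 0) (hroot : ∀ n : ℕ, 0 < n → (q 0 * q 1 * q 2 * q 3) ^ n ≠ 1) :
    Module.finrank K (HochschildRing K (GammaAlgebra 0 q)) = 4 ∧
    IsLocalRing (HochschildRing K (GammaAlgebra 0 q)) ∧
    Nonempty ((hochschildNilIdeal K (GammaAlgebra 0 q)).ringCon.Quotient ≃ₐ[K] K) := by
  obtain ⟨ρ, hρ⟩ := IsAlgClosed.exists_pow_nat_eq (q 0 * q 1 * q 2 * q 3) (n := 4) four_pos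
  have ρ_ne_zero : ρ ≠ 0 := by
    rintro rfl
    simp [hq] at hρ
  have not_finite_order : ¬IsOfFinOrder ρ := fun h => by
    obtain ⟨n, n_pos, hn⟩ := (h.pow (n := 4)).exists_pow_eq_one
    exact hroot n n_pos (hρ ▸ hn)
  have pow_injective := injective_pow_of_not_isOfFinOrder₀ ρ_ne_zero not_finite_order
  obtain ⟨c, hc₀, hc⟩ := GammaAlgebra.exists_rescaling hq hρ
  let S := GammaAlgebra.quantumCover hc₀ hc
  have connected := S.isConnectedGraded (by norm_num)
  have vanish := S.hochschild_subsingleton_of_three_le pow_injective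
  exact ⟨S.finrank_hochschildRing (by norm_num) pow_injective, connected.isLocalRing vanish,
    connected.nonempty_quotient_algEquiv vanish⟩
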